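/- Graphs are finite, may have multiple edges, loops and several connected components, and have no isolated vertices; every edge consists of two half-edges (an internal edge) or of a single half-edge (an external edge). For a set $\gamma\subset E(\Gamma)$ of edges, viewed as a subgraph, let $h_1(\gamma)=\dim H_1(\gamma,\mathbb{Q})$; the subgraph $\gamma$ is called core if $h_1(\gamma\setminus\{e\})<h_1(\gamma)$ for every $e\in\gamma$. Let $\Gamma$ be a core graph, and let $k$ be a subfield of $\mathbb{C}$ (for instance $\mathbb{Q}$, $\mathbb{R}$ or $\mathbb{C}$). Let $\mathbb{P}(\Gamma)$ be the projective space over $k$ with homogeneous coordinates $A_e$, $e\in E(\Gamma)$, let $\psi_\Gamma=\sum_T\prod_{e\notin T}A_e$, where $T$ runs through the spanning trees of $\Gamma$ (if $\Gamma$ is not connected: unions of one spanning tree for each connected component), and let $X_\Gamma\subset\mathbb{P}(\Gamma)$ be the hypersurface $\psi_\Gamma=0$. Let $L(\Gamma)$ be the set of the coordinate linear spaces $L_\mu: A_e=0\ (e\in\mu)$, where $\mu$ is the edge set of a core subgraph and $\emptyset\ne\mu\ne E(\Gamma)$. Let $L(\Gamma)_i$ ($i\ge 1$) be the set of minimal elements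 (under inclusion) of $L(\Gamma)\setminus\bigcup_{j<i}L(\Gamma)_j$. Let $\pi:P(\Gamma)\to\mathbb{P}(\Gamma)$ be the iterated blow-up obtained by successively blowing up, for $i=1,2,\dots$, the union of the strict transforms of the elements of $L(\Gamma)_i$, and let $Y\subset P(\Gamma)$ be the strict transform of $X_\Gamma$, that is, the closure of $\pi^{-1}\bigl(X_\Gamma\setminus\bigcup_{L\in L(\Gamma)}L\bigr)$. The variety $P(\Gamma)$ is a toric variety for the torus $\mathbb{G}_m^{E(\Gamma)}/\mathbb{G}_m$, so it is the disjoint union of torus orbits $T_\alpha$. The characters of the torus $T_\alpha$ are the Laurent monomials of degree $0$ in the $A_e$ that are regular and invertible along $T_\alpha$. Let $T_\alpha(\mathbb{R}^{>0})$ be the set of the points of $T_\alpha$ at which all these characters take positive real values, and let $P(\Gamma)(\mathbb{R}^{\ge 0})=\coprod_\alpha T_\alpha(\mathbb{R}^{>0})$ be the set of non-negative real points of $P(\Gamma)$. Then $Y$ does not meet $P(\Gamma)(\mathbb{R}^{\ge 0})$. -/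

import Mathlib

open scoped Classical in
/-- A graph: a finite set `H` of half-edges with surjections to the set `V` of vertices and to the
set `E` of edges (so there are no isolated vertices), where an edge consists of two half-edges
(internal edge) or of one half-edge (external edge). Loops and multiple edges are allowed, and a
graph need not be connected. -/
structure FeynmanGraph (H V E : Type*) [Fintype H] where
  vert : H → V
  edge : H → E
  vert_surjective : Function.Surjective vert
  edge_surjective : Function.Surjective edge
  card_fiber_le : ∀ e : E, (Finset.univ.filter fun h => edge h = e).card ≤ 2

namespace FeynmanGraph

variable {H V E : Type*} [Fintype H]

open scoped Classical in
/-- `H₁(γ, ℚ)` for the subgraph with edge set `γ`. We use the cell structure whose `0`-cells are the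
vertices and the (mid)points of the edges, and whose `1`-cells are the half-edges; the half-edge `h`
joins the vertex `vert h` to the point of `edge h`. There are no `2`-cells, so `H₁` is the space of
those `1`-chains supported on `γ` whose boundary vanishes. -/
def firstHomology (Γ : FeynmanGraph H V E) (γ : Finset E) : Submodule ℚ (H → ℚ) where
  carrier := {c | (∀ h, Γ.edge h ∉ γ → c h = 0) ∧
    (∀ v, ∑ h with Γ.vert h = v, c h = 0) ∧ (∀ e, ∑ h with Γ.edge h = e, c h = 0)}
  add_mem' := by
    rintro a b ⟨ha, ha', ha''⟩ ⟨hb, hb', hb''⟩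
    refine ⟨fun h hh => by simp [ha h hh, hb h hh], fun v => ?_, fun e => ?_⟩
    · simp [Finset.sum_add_distrib, ha' v, hb' v]
    · simp [Finset.sum_add_distrib, ha'' e, hb'' e]
  zero_mem' := ⟨fun _ _ => rfl, fun _ => by simp, fun _ => by simp⟩
  smul_mem' := by
    rintro r a ⟨ha, ha', ha''⟩
    refine ⟨fun h hh => by simp [ha h hh], fun v => ?_, fun e => ?_⟩
    · simp [← Finset.mul_sum, ha' v]
    · simp [← Finset.mul_sum, ha'' e]

/-- The loop number `h₁(γ)` of the subgraph with edge set `γ`. -/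
noncomputable def loopNumber (Γ : FeynmanGraph H V E) (γ : Finset E) : ℕ :=
  Module.finrank ℚ (Γ.firstHomology γ)

open scoped Classical in
/-- The subgraph with edge set `γ` is a core graph: removing any of its edges lowers the loop
number. -/
def IsCoreSubgraph (Γ : FeynmanGraph H V E) (γ : Finset E) : Prop :=
  ∀ e ∈ γ, Γ.loopNumber (γ.erase e) < Γ.loopNumber γ

/-- The graph itself is a core graph. -/
def IsCore [Fintype E] (Γ : FeynmanGraph H V E) : Prop :=
  Γ.IsCoreSubgraph Finset.univ

/-- Two vertices lie in the same connected component of the graph with vertex set `V` and edge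
set `T`. -/
def Joined (Γ : FeynmanGraph H V E) (T : Finset E) : V → V → Prop :=
  Relation.EqvGen fun v w =>
    ∃ h h' : H, Γ.edge h = Γ.edge h' ∧ Γ.edge h ∈ T ∧ Γ.vert h = v ∧ Γ.vert h' = w

/-- `T` is (the edge set of) a spanning tree of `Γ`. For a graph that is not connected, this means
a spanning tree in every connected component. -/
def IsSpanningTree [Fintype E] (Γ : FeynmanGraph H V E) (T : Finset E) : Prop :=
  Γ.loopNumber T = 0 ∧ ∀ v w, Γ.Joined Finset.univ v w → Γ.Joined T v w

open scoped Classical in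
/-- The graph polynomial `ψ_Γ = ∑_T ∏_{e ∉ T} A_e`, with `T` running through the spanning trees. -/
noncomputable def graphPolynomial [Fintype E] (Γ : FeynmanGraph H V E) (k : Type*) [Field k] :
    MvPolynomial E k :=
  ∑ T with Γ.IsSpanningTree T, ∏ e ∈ Tᶜ, MvPolynomial.X e

end FeynmanGraph

/-! ### Varieties as models of a field

A (separated, integral) algebraic variety over `k` with function field contained in `K` is given by
the set of its local rings, which are local subrings of `K` (Zariski's language of models). The
points are all scheme-theoretic points. A birational morphism maps a local ring `R'` to the local
ring `R` that is dominated by `R'`, that is, `R ≤ R'` in the order of `LocalSubring K`. -/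

namespace Model

variable {K : Type*} [Field K]

/-- The maximal ideal of a local subring, as a subset of the field. -/
def maxIdeal (R : LocalSubring K) : Set K :=
  {a | ∃ h : a ∈ R.toSubring, (⟨a, h⟩ : R.toSubring) ∈ IsLocalRing.maximalIdeal R.toSubring}

/-- The affine model `Spec B`: all localizations of `B` at prime ideals. -/
def spec (B : Subring K) : Set (LocalSubring K) :=
  {R | ∃ (p : Ideal B) (_ : p.IsPrime), R = LocalSubring.ofPrime B p}

/-- The Zariski topology: it is generated by the domains of definition `{R | f ∈ R}` of the
elements `f` of the field. (An affine open set `Spec k[f₁, …, f_r]` of a model `M` is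
`{R ∈ M | f₁, …, f_r ∈ R}`, so the subspace topology on a model is its Zariski topology.) -/
@[reducible] def zariskiTopology (K : Type*) [Field K] : TopologicalSpace (LocalSubring K) :=
  TopologicalSpace.generateFrom (Set.range fun f : K => {R | f ∈ R.toSubring})

/-- The closure of a subset `W` in the model `M`. -/
def closureIn (M W : Set (LocalSubring K)) : Set (LocalSubring K) :=
  M ∩ @closure _ (zariskiTopology K) W

/-- The stalk at `R` of the ideal sheaf of the closed subset `Z` with its reduced structure: the
elements of `R` that vanish at all those points of `Z` of which `R` is a specialization. -/
def stalkIdeal (Z : Set (LocalSubring K)) (R : LocalSubring K) : Set K :=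
  {a | a ∈ R.toSubring ∧ ∀ S ∈ Z, R.toSubring ≤ S.toSubring → a ∈ maxIdeal S}

/-- The blow-up of the model `M` along the closed subset `Z` with its reduced structure. If `I` is
the ideal of `Z` at the point `R`, the points over `R` are the points over `R` of the charts
`Spec R[I / f]`, for `0 ≠ f ∈ I`. -/
def blowUp (M Z : Set (LocalSubring K)) : Set (LocalSubring K) :=
  {R' | ∃ R ∈ M, ∃ f ∈ stalkIdeal Z R, f ≠ 0 ∧ R ≤ R' ∧
    R' ∈ spec (Subring.closure ((R.toSubring : Set K) ∪ {b | ∃ a ∈ stalkIdeal Z R, b = a / f}))}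

end Model

/-! ### Projective space and its iterated blow-ups along coordinate linear spaces -/

namespace Proj

/-- The field `k(A_e, e ∈ E)`. The function field of the projective space with homogeneous
coordinates `A_e` is its subfield of elements of degree zero. -/
abbrev FunField (k E : Type*) [Field k] : Type _ := FractionRing (MvPolynomial E k)

variable (k : Type*) [Field k] {E : Type*}

/-- The homogeneous coordinate `A_e`. -/
noncomputable def coord (e : E) : FunField k E :=
  algebraMap (MvPolynomial E k) (FunField k E) (MvPolynomial.X e)

/-- The coordinate ring `k[A_f / A_e, f ∈ E]` of the affine chart `A_e ≠ 0`. -/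
noncomputable def chart (e : E) : Subring (FunField k E) :=
  (Algebra.adjoin k (Set.range fun f : E => coord k f / coord k e)).toSubring

variable (E) in
/-- The projective space over `k` with homogeneous coordinates `A_e`, `e ∈ E`. -/
def space : Set (LocalSubring (FunField k E)) :=
  ⋃ e : E, Model.spec (chart k e)

variable {k}

/-- The closed subset `F = 0` of the projective space, for a homogeneous polynomial `F`: the points
`R` at which, in an affine chart `A_e ≠ 0` containing `R`, the dehomogenized polynomial vanishes. -/
def zeroLocus (F : MvPolynomial E k) : Set (LocalSubring (FunField k E)) :=
  {R | R ∈ space k E ∧ ∃ e : E, chart k e ≤ R.toSubring ∧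
    MvPolynomial.aeval (fun f => coord k f / coord k e) F ∈ Model.maxIdeal R}

variable (k)

/-- The coordinate linear space `L_μ : A_e = 0, e ∈ μ`. -/
def linearSpace (μ : Finset E) : Set (LocalSubring (FunField k E)) :=
  {R | R ∈ space k E ∧ ∀ e ∈ μ, R ∈ zeroLocus (MvPolynomial.X e : MvPolynomial E k)}

/-- For a set `S` of index sets `μ`, those that are left after `i` steps when in each step the
minimal spaces `L_μ` are removed, that is, the maximal `μ` (as `μ ↦ L_μ` reverses inclusions). -/
def remaining (S : Set (Finset E)) : ℕ → Set (Finset E)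
  | 0 => S
  | i + 1 => {μ | μ ∈ remaining S i ∧ ¬ Maximal (· ∈ remaining S i) μ}

/-- The `i`-th stratum (counting from `0`): the `μ` for which `L_μ` is minimal among the linear
spaces that remain after the previous strata are removed. -/
def stratum (S : Set (Finset E)) (i : ℕ) : Set (Finset E) :=
  {μ | Maximal (· ∈ remaining S i) μ}

theorem card_add_lt_of_mem_remaining [Fintype E] {S : Set (Finset E)} (hS : Finset.univ ∉ S) :
    ∀ (i : ℕ) (μ : Finset E), μ ∈ remaining S i → μ.card + i < Fintype.card E
  | 0, μ, h => by
      have : μ ≠ Finset.univ := fun hμ => hS (hμ ▸ h)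
      simpa using lt_of_le_of_ne (Finset.card_le_univ μ)
        (fun hc => this (Finset.card_eq_iff_eq_univ μ |>.1 hc))
  | i + 1, μ, h => by
      obtain ⟨h1, h2⟩ := h
      obtain ⟨ν, hν, hlt⟩ := (not_maximal_iff_exists_gt h1).1 h2
      have := card_add_lt_of_mem_remaining hS i ν hlt
      have := Finset.card_lt_card hν
      omega

/-- After `card E` steps nothing is left: the iterated blow-up below is complete by then. -/
theorem remaining_card [Fintype E] {S : Set (Finset E)} (hS : Finset.univ ∉ S) :
    remaining S (Fintype.card E) = ∅ := by
  ext μ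
  simp only [Set.mem_empty_iff_false, iff_false]
  intro h
  have := card_add_lt_of_mem_remaining hS _ μ h
  omega

/-- The points of the projective space that lie on one of the linear spaces of the first `i`
strata. -/
def blownUpLocus (S : Set (Finset E)) (i : ℕ) : Set (LocalSubring (FunField k E)) :=
  ⋃ j < i, ⋃ μ ∈ stratum S j, linearSpace k μ

/-- The strict transform of the closed subset `W` of the projective space in the model `M`, which
is thought of as the result of blowing up the first `i` strata: the closure in `M` of the inverse
image of the part of `W` outside the blown up linear spaces (over the complement of these spaces,
`M` is isomorphic to the projective space). -/
def strictTransformIn (S : Set (Finset E)) (i : ℕ) (M W : Set (LocalSubring (FunField k E))) :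
    Set (LocalSubring (FunField k E)) :=
  Model.closureIn M {R' | R' ∈ M ∧ ∃ R ∈ W, R ∉ blownUpLocus k S i ∧ R ≤ R'}

/-- The iterated blow-up: in step `i + 1`, blow up the (disjoint) union of the strict transforms of
the linear spaces in the next stratum. -/
def iteratedBlowUp (S : Set (Finset E)) : ℕ → Set (LocalSubring (FunField k E))
  | 0 => space k E
  | i + 1 => Model.blowUp (iteratedBlowUp S i)
      (⋃ μ ∈ stratum S i, strictTransformIn k S i (iteratedBlowUp S i) (linearSpace k μ))

/-- The Laurent monomial `∏ A_e ^ (m e)`. -/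
noncomputable def character [Fintype E] (m : E → ℤ) : FunField k E :=
  ∏ e, coord k e ^ m e

/-- The character lattice of the torus orbit through the point `R`: those characters of the big
torus `𝔾_m^E / 𝔾_m` (Laurent monomials of degree zero) that are regular and invertible at `R`. The
orbit is the torus with these characters. -/
def orbitLattice [Fintype E] (R : LocalSubring (FunField k E)) : Set (E → ℤ) :=
  {m | ∑ e, m e = 0 ∧ character k m ∈ R.toSubring ∧ (character k m)⁻¹ ∈ R.toSubring}

/-- A complex point `Spec ℂ → M` over `k` of a model `M`: a point of the model and a local
homomorphism of `k`-algebras from its local ring to `ℂ`. -/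
structure ComplexPoint [Algebra k ℂ] (M : Set (LocalSubring (FunField k E))) where
  localRing : LocalSubring (FunField k E)
  mem : localRing ∈ M
  eval : localRing.toSubring →+* ℂ
  isLocalHom_eval : IsLocalHom eval
  eval_algebraMap : ∀ (c : k) (h : algebraMap k (FunField k E) c ∈ localRing.toSubring),
    eval ⟨algebraMap k (FunField k E) c, h⟩ = algebraMap k ℂ c

/-- The complex points of `M` that lie on the subset `Y`. -/
def pointsOn [Algebra k ℂ] (M Y : Set (LocalSubring (FunField k E))) : Set (ComplexPoint k M) :=
  {x | x.localRing ∈ Y}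

/-- The non-negative real points `M(ℝ^{≥0})` of a toric variety `M`: the disjoint union over the
torus orbits of the positive real points of the orbit, which are the points at which all characters
of the orbit take positive real values. -/
def nonnegPoints [Fintype E] [Algebra k ℂ] (M : Set (LocalSubring (FunField k E))) :
    Set (ComplexPoint k M) :=
  {x | ∀ (m : E → ℤ) (h : m ∈ orbitLattice k x.localRing),
    ∃ r : ℝ, 0 < r ∧ x.eval ⟨character k m, h.2.1⟩ = (r : ℂ)}

end Proj

namespace FeynmanGraph

variable {H V E : Type*} [Fintype H] [Fintype E]

/-- The index sets of the linear spaces to be blown up: the edge sets `μ` of the core subgraphs for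
which `L_μ` is a non-empty proper subspace of the projective space. -/
def coreSubgraphs (Γ : FeynmanGraph H V E) : Set (Finset E) :=
  {μ | μ.Nonempty ∧ μ ≠ Finset.univ ∧ Γ.IsCoreSubgraph μ}

/-- The iterated blow-up `P(Γ)`. -/
def blowUp (Γ : FeynmanGraph H V E) (k : Type*) [Field k] :
    Set (LocalSubring (Proj.FunField k E)) :=
  Proj.iteratedBlowUp k Γ.coreSubgraphs (Fintype.card E)

/-- The graph hypersurface `X_Γ : ψ_Γ = 0`. -/
def hypersurface (Γ : FeynmanGraph H V E) (k : Type*) [Field k] :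
    Set (LocalSubring (Proj.FunField k E)) :=
  Proj.zeroLocus (Γ.graphPolynomial k)

/-- The strict transform `Y` of `X_Γ` in `P(Γ)`. -/
def strictTransform (Γ : FeynmanGraph H V E) (k : Type*) [Field k] :
    Set (LocalSubring (Proj.FunField k E)) :=
  Proj.strictTransformIn k Γ.coreSubgraphs (Fintype.card E) (Γ.blowUp k) (Γ.hypersurface k)

end FeynmanGraph

/-!
For a spanning tree `T` let `A^T` denote the monomial `∏ e ∉ T, A_e`, so that `ψ = ∑ T, A^T`.

The theorem rests on a divisibility statement: at every point of `P(Γ)` one of the monomials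
`A^T₀` divides all the others in the local ring (`exists_isSpanningTree_prod_div_prod_mem`).
Granted this, `ψ = A^T₀ · F` with `F = ∑ T, A^T / A^T₀` regular. At a non-negative point the value
of a regular quotient `A^T / A^T₀` is positive if the quotient is invertible there, since it is then
a character of the orbit, and zero otherwise; the quotient with `T = T₀` is `1`. Hence `F` is
invertible near the point. A point near it over a point `R₀` of `X_Γ` outside all the `L_μ` cannot
exist: the edges whose coordinates vanish at `R₀` contain no core subgraph, hence lie in a spanning
tree `T₁`, and `A^T₁` does not vanish there. So neither do its divisor `A^T₀` and `ψ = A^T₀ · F`.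

For the divisibility, call `e ∈ ν` a pivot of the edge set `ν` at a point if `A_e` divides all `A_f`
with `f ∈ ν` in the local ring. If every core subgraph has a pivot, a greedy algorithm produces
`T₀`: remove a pivot of the core of `Γ`, then a pivot of the core of what is left, and so on, until
no cycle remains (`exists_prod_div_prod_mem`); the exchange property of spanning trees shows that
the product of the removed pivots divides every `A^T`.

That every core subgraph has a pivot at every point of `P(Γ)` says that the ideals of the `L_μ`
become principal. It is proved by induction along the blow-ups for any family of index sets closed
under unions (`IsToricPoint.succ`), together with the fact that each local ring is a localization
of the algebra generated by the `A_f / A_e` for the pivots `e` of the sets `ν ∋ f` treated so far.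
In the inductive step for `μ`, either a pivot of some treated `ν ⊇ μ` lies in `μ`, and the point is
not on the strict transform of `L_μ`; or the point specializes the generic point of `L_μ`, and the
ideal of the strict transform is generated by the `A_f / A_x`, `f ∈ μ`, where `A_x` is the last
pivot of the treated sets containing `μ` in the order of divisibility
(`IsToricPoint.exists_span_eq_stalkIdeal`). In the second case a blow-up at this ideal makes one of
these quotients divide the others.
-/

/-! ### Local rings of models and of blow-ups -/

namespace Model

variable {K : Type*} [Field K]

theorem mem_maxIdeal_iff {R : LocalSubring K} {a : K} :
    a ∈ maxIdeal R ↔ a ∈ R.toSubring ∧ (a⁻¹ ∈ R.toSubring → a = 0) := by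
  constructor
  · rintro ⟨h, hm⟩
    refine ⟨h, fun hi => ?_⟩
    by_contra h0
    rw [IsLocalRing.mem_maximalIdeal, mem_nonunits_iff] at hm
    exact hm (IsUnit.of_mul_eq_one (⟨a⁻¹, hi⟩ : R.toSubring) (Subtype.ext (mul_inv_cancel₀ h0)))
  · rintro ⟨h, hi⟩
    refine ⟨h, ?_⟩
    rw [IsLocalRing.mem_maximalIdeal, mem_nonunits_iff]
    intro hu
    obtain ⟨b, hb⟩ := hu.exists_right_inv
    have hb' : a * (b : K) = 1 := congrArg Subtype.val hb
    have h0 : a ≠ 0 := left_ne_zero_of_mul_eq_one hb'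
    refine h0 (hi ?_)
    rw [← eq_inv_of_mul_eq_one_right hb']
    exact b.2

theorem inv_mem_of_notMem_maxIdeal {R : LocalSubring K} {a : K} (h : a ∈ R.toSubring)
    (hm : a ∉ maxIdeal R) : a⁻¹ ∈ R.toSubring := by
  by_contra hi
  exact hm (mem_maxIdeal_iff.2 ⟨h, fun h' => absurd h' hi⟩)

theorem add_mem_maxIdeal {R : LocalSubring K} {a b : K} (ha : a ∈ maxIdeal R)
    (hb : b ∈ maxIdeal R) : a + b ∈ maxIdeal R := by
  obtain ⟨h, hm⟩ := ha
  obtain ⟨h', hm'⟩ := hb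
  exact ⟨R.toSubring.add_mem h h', Ideal.add_mem _ hm hm'⟩

theorem mul_mem_maxIdeal {R : LocalSubring K} {a b : K} (ha : a ∈ R.toSubring)
    (hb : b ∈ maxIdeal R) : a * b ∈ maxIdeal R := by
  obtain ⟨h', hm'⟩ := hb
  exact ⟨R.toSubring.mul_mem ha h', Ideal.mul_mem_left _ (⟨a, ha⟩ : R.toSubring) hm'⟩

theorem zero_mem_maxIdeal (R : LocalSubring K) : (0 : K) ∈ maxIdeal R :=
  mem_maxIdeal_iff.2 ⟨R.toSubring.zero_mem, fun _ => rfl⟩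

theorem maxIdeal_subset_of_le {R S : LocalSubring K} (h : R ≤ S) : maxIdeal R ⊆ maxIdeal S := by
  rintro a ⟨ha, hm⟩
  obtain ⟨hle, hloc⟩ := h
  refine ⟨hle ha, ?_⟩
  rw [IsLocalRing.mem_maximalIdeal, mem_nonunits_iff] at hm ⊢
  exact fun hu => hm (hloc.map_nonunit _ hu)

theorem mem_ofPrime_iff (B : Subring K) (p : Ideal B) [p.IsPrime] (r : K) :
    r ∈ (LocalSubring.ofPrime B p).toSubring ↔ ∃ a b : B, b ∉ p ∧ r = a / b := by
  constructor
  · intro hr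
    obtain ⟨⟨a, b⟩, hab⟩ := IsLocalization.surj p.primeCompl
      (⟨r, hr⟩ : (LocalSubring.ofPrime B p).toSubring)
    have h : r * (b : B) = (a : K) := congrArg Subtype.val hab
    have hb0 : ((b : B) : K) ≠ 0 := fun h0 => b.2 <| by
      rw [show (b : B) = 0 from Subtype.ext h0]
      exact p.zero_mem
    exact ⟨a, b, b.2, (eq_div_iff hb0).2 h⟩
  · rintro ⟨a, b, hb, rfl⟩
    obtain ⟨c, hc⟩ := (IsLocalization.map_units (LocalSubring.ofPrime B p).toSubring
      (⟨b, hb⟩ : p.primeCompl)).exists_right_inv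
    have hc' : (b : K) * (c : K) = 1 := congrArg Subtype.val hc
    rw [div_eq_mul_inv, ← eq_inv_of_mul_eq_one_right hc']
    exact Subring.mul_mem _ (LocalSubring.le_ofPrime B p a.2) c.2

theorem le_of_mem_spec {B : Subring K} {R : LocalSubring K} (h : R ∈ spec B) :
    B ≤ R.toSubring := by
  obtain ⟨p, hp, rfl⟩ := h
  exact LocalSubring.le_ofPrime B p

theorem exists_eq_div_of_mem_spec {B : Subring K} {R : LocalSubring K} (h : R ∈ spec B) {r : K}
    (hr : r ∈ R.toSubring) : ∃ a ∈ B, ∃ b ∈ B, b ≠ 0 ∧ b⁻¹ ∈ R.toSubring ∧ r = a / b := by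
  obtain ⟨p, hp, rfl⟩ := h
  obtain ⟨a, b, hb, rfl⟩ := (mem_ofPrime_iff B p r).1 hr
  refine ⟨a, a.2, b, b.2, fun h0 => hb ?_, (mem_ofPrime_iff B p _).2 ⟨1, b, hb, by simp⟩, rfl⟩
  rw [show b = 0 from Subtype.ext h0]
  exact p.zero_mem

theorem mem_spec_toSubring (R : LocalSubring K) : R ∈ spec R.toSubring := by
  refine ⟨IsLocalRing.maximalIdeal R.toSubring, inferInstance, LocalSubring.toSubring_injective ?_⟩
  refine le_antisymm (LocalSubring.le_ofPrime _ _) fun r hr => ?_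
  obtain ⟨a, b, hb, rfl⟩ := (mem_ofPrime_iff _ _ r).1 hr
  rw [div_eq_mul_inv]
  refine R.toSubring.mul_mem a.2 (inv_mem_of_notMem_maxIdeal b.2 ?_)
  rintro ⟨h, hm⟩
  exact hb hm

/-- Over a point at which the ideal of the centre is the unit ideal, the blow-up changes nothing. -/
theorem mem_blowUp_of_one_mem_stalkIdeal {M Z : Set (LocalSubring K)} {R : LocalSubring K}
    (hR : R ∈ M) (h1 : (1 : K) ∈ stalkIdeal Z R) : R ∈ blowUp M Z := by
  refine ⟨R, hR, 1, h1, one_ne_zero, le_rfl, ?_⟩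
  have : Subring.closure ((R.toSubring : Set K) ∪ {b | ∃ a ∈ stalkIdeal Z R, b = a / 1}) =
      R.toSubring := by
    refine le_antisymm (Subring.closure_le.2 ?_) fun r hr => Subring.subset_closure (Or.inl hr)
    rintro b (hb | ⟨a, ha, rfl⟩)
    · exact hb
    · simpa using ha.1
  rw [this]
  exact mem_spec_toSubring R

/-- Finitely many functions that are regular at a point of the closure of `W` are simultaneously
regular at some point of `W`. -/
theorem exists_mem_of_mem_closureIn {M W : Set (LocalSubring K)} {S : LocalSubring K}
    (h : S ∈ closureIn M W) {ι : Type*} [Finite ι] (f : ι → K) (hf : ∀ i, f i ∈ S.toSubring) :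
    ∃ S' ∈ W, ∀ i, f i ∈ S'.toSubring := by
  let _ := zariskiTopology K
  have hopen : IsOpen (⋂ i, {R : LocalSubring K | f i ∈ R.toSubring}) :=
    isOpen_iInter_of_finite fun i => TopologicalSpace.isOpen_generateFrom_of_mem ⟨f i, rfl⟩
  obtain ⟨S', h1, h2⟩ := mem_closure_iff.1 h.2 _ hopen (Set.mem_iInter.2 hf)
  exact ⟨S', h2, Set.mem_iInter.1 h1⟩

theorem mem_closureIn_of_mem {M W : Set (LocalSubring K)} {S : LocalSubring K} (hM : S ∈ M)
    (hW : S ∈ W) : S ∈ closureIn M W :=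
  let _ := zariskiTopology K
  ⟨hM, subset_closure hW⟩

/-- The elements that can be written as a fraction of elements of `B` with a denominator invertible
in `R`. When `B` is contained in `R`, this is the localization of `B` at the centre of `R`. -/
def fractionsIn (B R : Subring K) : Subring K where
  carrier := {r | ∃ a ∈ B, ∃ b ∈ B, b ≠ 0 ∧ b⁻¹ ∈ R ∧ r = a / b}
  zero_mem' := ⟨0, B.zero_mem, 1, B.one_mem, one_ne_zero, by simp [R.one_mem], by simp⟩
  one_mem' := ⟨1, B.one_mem, 1, B.one_mem, one_ne_zero, by simp [R.one_mem], by simp⟩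
  add_mem' := by
    rintro _ _ ⟨a, ha, b, hb, hb0, hbi, rfl⟩ ⟨c, hc, d, hd, hd0, hdi, rfl⟩
    exact ⟨a * d + b * c, B.add_mem (B.mul_mem ha hd) (B.mul_mem hb hc), b * d, B.mul_mem hb hd,
      mul_ne_zero hb0 hd0, by rw [mul_inv]; exact R.mul_mem hbi hdi, div_add_div _ _ hb0 hd0⟩
  mul_mem' := by
    rintro _ _ ⟨a, ha, b, hb, hb0, hbi, rfl⟩ ⟨c, hc, d, hd, hd0, hdi, rfl⟩
    exact ⟨a * c, B.mul_mem ha hc, b * d, B.mul_mem hb hd,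
      mul_ne_zero hb0 hd0, by rw [mul_inv]; exact R.mul_mem hbi hdi, div_mul_div_comm _ _ _ _⟩
  neg_mem' := by
    rintro _ ⟨a, ha, b, hb, hb0, hbi, rfl⟩
    exact ⟨-a, B.neg_mem ha, b, hb, hb0, hbi, (neg_div _ _).symm⟩

section fractionsIn

variable {B R : Subring K}

theorem le_fractionsIn : B ≤ fractionsIn B R := fun a ha =>
  ⟨a, ha, 1, B.one_mem, one_ne_zero, by simp [R.one_mem], by simp⟩

theorem inv_mem_fractionsIn {r : K} (hr : r ∈ fractionsIn B R) (hi : r⁻¹ ∈ R) :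
    r⁻¹ ∈ fractionsIn B R := by
  obtain ⟨a, ha, b, hb, hb0, hbi, rfl⟩ := hr
  rcases eq_or_ne a 0 with rfl | ha0
  · simp [(fractionsIn B R).zero_mem]
  · refine ⟨b, hb, a, ha, ha0, ?_, inv_div a b⟩
    have : a⁻¹ = (a / b)⁻¹ * b⁻¹ := by field_simp
    rw [this]
    exact R.mul_mem hi hbi

/-- If the coordinate ring `C` consists of fractions, then so do its localizations. -/
theorem le_fractionsIn_of_mem_spec {B C : Subring K} {S : LocalSubring K}
    (hS : S ∈ spec C)
    (hC : C ≤ fractionsIn B S.toSubring) :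
    S.toSubring ≤ fractionsIn B S.toSubring := by
  intro r hr
  obtain ⟨a, ha, b, hb, -, hbi, rfl⟩ := exists_eq_div_of_mem_spec hS hr
  rw [div_eq_mul_inv]
  exact Subring.mul_mem _ (hC ha) (inv_mem_fractionsIn (hC hb) hbi)

end fractionsIn

end Model

/-! ### The generic point of a coordinate linear space -/

namespace Proj

variable {k : Type*} [Field k] {E : Type*}

theorem coord_ne_zero (e : E) : coord k e ≠ 0 := by
  unfold coord
  rw [Ne, FaithfulSMul.algebraMap_eq_zero_iff]
  exact MvPolynomial.X_ne_zero e

theorem algebraMap_mem_chart (e : E) (c : k) : algebraMap k (FunField k E) c ∈ chart k e :=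
  Subalgebra.algebraMap_mem _ c

theorem coord_div_coord_mem_chart (e f : E) : coord k f / coord k e ∈ chart k e :=
  Algebra.subset_adjoin ⟨f, rfl⟩

theorem adjoin_toSubring_le {G : Set (FunField k E)} {R : Subring (FunField k E)}
    (hc : ∀ c : k, algebraMap k (FunField k E) c ∈ R) (hG : G ⊆ R) :
    (Algebra.adjoin k G).toSubring ≤ R := by
  intro r hr
  induction (show r ∈ Algebra.adjoin k G from hr) using Algebra.adjoin_induction with
  | mem x hx => exact hG hx
  | algebraMap c => exact hc c
  | add x y hx hy h h' => exact R.add_mem (h hx) (h' hy)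
  | mul x y hx hy h h' => exact R.mul_mem (h hx) (h' hy)

theorem chart_le {e : E} {R : Subring (FunField k E)}
    (hc : ∀ c : k, algebraMap k (FunField k E) c ∈ R) (h : ∀ f, coord k f / coord k e ∈ R) :
    chart k e ≤ R :=
  adjoin_toSubring_le hc (by rintro _ ⟨f, rfl⟩; exact h f)

open scoped Classical in
variable (k) in
/-- The substitution `A_e = 0` for `e ∈ μ`. -/
noncomputable def killVars (μ : Finset E) : MvPolynomial E k →ₐ[k] MvPolynomial E k :=
  MvPolynomial.aeval fun e => if e ∈ μ then 0 else MvPolynomial.X e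

variable (k) in
/-- The prime ideal of the linear subspace `A_e = 0`, `e ∈ μ`, of the affine space. -/
noncomputable def linearIdeal (μ : Finset E) : Ideal (MvPolynomial E k) :=
  RingHom.ker (killVars k μ : MvPolynomial E k →+* MvPolynomial E k)

instance linearIdeal_isPrime (μ : Finset E) : (linearIdeal k μ).IsPrime :=
  RingHom.ker_isPrime _

theorem mem_linearIdeal {μ : Finset E} {p : MvPolynomial E k} :
    p ∈ linearIdeal k μ ↔ killVars k μ p = 0 :=
  Iff.rfl

variable (k) in
/-- The ring of the rational functions in the variables `A_e` that are regular at the generic point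
of the linear subspace `A_e = 0`, `e ∈ μ`, of the affine space. -/
noncomputable def regularRing (μ : Finset E) : Subring (FunField k E) :=
  (Localization.subalgebra.ofField (FunField k E) (linearIdeal k μ).primeCompl
    (Ideal.primeCompl_le_nonZeroDivisors _)).toSubring

variable (k) in
/-- The restriction of rational functions to the linear subspace `A_e = 0`, `e ∈ μ`. -/
noncomputable def restrict (μ : Finset E) : regularRing k μ →+* FunField k E :=
  IsLocalization.lift (M := (linearIdeal k μ).primeCompl)
    (S := Localization.subalgebra.ofField (FunField k E) (linearIdeal k μ).primeCompl
      (Ideal.primeCompl_le_nonZeroDivisors _))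
    (g := (algebraMap (MvPolynomial E k) (FunField k E)).comp
      (killVars k μ : MvPolynomial E k →+* MvPolynomial E k))
    fun y => by
      rw [isUnit_iff_ne_zero, RingHom.comp_apply, Ne, FaithfulSMul.algebraMap_eq_zero_iff]
      exact fun h => y.2 (mem_linearIdeal.2 h)

theorem algebraMap_mem_regularRing (μ : Finset E) (p : MvPolynomial E k) :
    algebraMap (MvPolynomial E k) (FunField k E) p ∈ regularRing k μ :=
  Subalgebra.algebraMap_mem (Localization.subalgebra.ofField (FunField k E)
    (linearIdeal k μ).primeCompl (Ideal.primeCompl_le_nonZeroDivisors _)) p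

theorem restrict_algebraMap (μ : Finset E) (p : MvPolynomial E k) :
    restrict k μ ⟨algebraMap _ _ p, algebraMap_mem_regularRing μ p⟩ =
      algebraMap _ _ (killVars k μ p) :=
  IsLocalization.lift_eq (M := (linearIdeal k μ).primeCompl)
    (S := Localization.subalgebra.ofField (FunField k E) (linearIdeal k μ).primeCompl
      (Ideal.primeCompl_le_nonZeroDivisors _)) _ p

theorem mem_regularRing_iff {μ : Finset E} {r : FunField k E} :
    r ∈ regularRing k μ ↔ ∃ p q : MvPolynomial E k, killVars k μ q ≠ 0 ∧
      r = algebraMap _ _ p * (algebraMap _ _ q)⁻¹ := by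
  constructor
  · rintro ⟨p, q, hq, h⟩
    exact ⟨p, q, hq, h⟩
  · rintro ⟨p, q, hq, h⟩
    exact ⟨p, q, hq, h⟩

theorem coord_mem_regularRing (μ : Finset E) (e : E) : coord k e ∈ regularRing k μ :=
  algebraMap_mem_regularRing μ _

theorem restrict_coord_of_mem {μ : Finset E} {e : E} (he : e ∈ μ) :
    restrict k μ ⟨coord k e, coord_mem_regularRing μ e⟩ = 0 :=
  (restrict_algebraMap μ (MvPolynomial.X e)).trans (by simp [killVars, he])

theorem restrict_coord_of_notMem {μ : Finset E} {e : E} (he : e ∉ μ) :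
    restrict k μ ⟨coord k e, coord_mem_regularRing μ e⟩ = coord k e :=
  (restrict_algebraMap μ (MvPolynomial.X e)).trans (by simp [killVars, he, coord])

theorem inv_coord_mem_regularRing {μ : Finset E} {e : E} (he : e ∉ μ) :
    (coord k e)⁻¹ ∈ regularRing k μ := by
  refine mem_regularRing_iff.2 ⟨1, MvPolynomial.X e, ?_, ?_⟩
  · simp [killVars, he]
  · simp [coord]

theorem coord_div_coord_mem_regularRing {μ : Finset E} {e : E} (he : e ∉ μ) (f : E) :
    coord k f / coord k e ∈ regularRing k μ := by
  rw [div_eq_mul_inv]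
  exact Subring.mul_mem _ (coord_mem_regularRing μ f) (inv_coord_mem_regularRing he)

theorem const_mem_regularRing (μ : Finset E) (c : k) :
    algebraMap k (FunField k E) c ∈ regularRing k μ := by
  rw [IsScalarTower.algebraMap_apply k (MvPolynomial E k)]
  exact algebraMap_mem_regularRing _ _

theorem restrict_const (μ : Finset E) (c : k) :
    restrict k μ ⟨algebraMap k (FunField k E) c, const_mem_regularRing μ c⟩ =
      algebraMap k (FunField k E) c := by
  have := restrict_algebraMap (k := k) μ (algebraMap k _ c)
  rw [AlgHom.commutes] at this
  simpa only [← IsScalarTower.algebraMap_apply] using this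

theorem restrict_mul_coord {μ : Finset E} {e : E} (he : e ∉ μ) (f : E) :
    restrict k μ ⟨coord k f / coord k e, coord_div_coord_mem_regularRing he f⟩ * coord k e =
      restrict k μ ⟨coord k f, coord_mem_regularRing μ f⟩ := by
  have h : restrict k μ ⟨coord k f / coord k e, coord_div_coord_mem_regularRing he f⟩ *
      restrict k μ ⟨coord k e, coord_mem_regularRing μ e⟩ =
        restrict k μ ⟨coord k f, coord_mem_regularRing μ f⟩ := by
    rw [← map_mul]
    congr 1
    exact Subtype.ext (div_mul_cancel₀ _ (coord_ne_zero e))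
  rwa [restrict_coord_of_notMem he] at h

theorem restrict_coord_div_coord_of_mem {μ : Finset E} {e f : E} (he : e ∉ μ) (hf : f ∈ μ) :
    restrict k μ ⟨coord k f / coord k e, coord_div_coord_mem_regularRing he f⟩ = 0 := by
  have := restrict_mul_coord (k := k) he f
  rw [restrict_coord_of_mem hf] at this
  exact (mul_eq_zero.1 this).resolve_right (coord_ne_zero e)

theorem restrict_coord_div_coord_of_notMem {μ : Finset E} {e f : E} (he : e ∉ μ) (hf : f ∉ μ) :
    restrict k μ ⟨coord k f / coord k e, coord_div_coord_mem_regularRing he f⟩ =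
      coord k f / coord k e := by
  have := restrict_mul_coord (k := k) he f
  rw [restrict_coord_of_notMem hf] at this
  exact eq_div_of_mul_eq (coord_ne_zero e) this

theorem chart_le_regularRing {μ : Finset E} {e : E} (he : e ∉ μ) :
    chart k e ≤ regularRing k μ :=
  chart_le (const_mem_regularRing μ) (coord_div_coord_mem_regularRing he)

variable (k) in
/-- The prime ideal of the linear space `L_μ` in the chart `A_e ≠ 0`, where `e ∉ μ`. -/
noncomputable def chartIdeal {μ : Finset E} {e : E} (he : e ∉ μ) : Ideal (chart k e) :=
  RingHom.ker ((restrict k μ).comp (Subring.inclusion (chart_le_regularRing he)))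

instance chartIdeal_isPrime {μ : Finset E} {e : E} (he : e ∉ μ) : (chartIdeal k he).IsPrime :=
  RingHom.ker_isPrime _

variable (k) in
/-- The generic point of the linear space `L_μ`, constructed in the chart `A_e ≠ 0`, where
`e ∉ μ`. -/
noncomputable def genericPoint {μ : Finset E} {e : E} (he : e ∉ μ) : LocalSubring (FunField k E) :=
  LocalSubring.ofPrime (chart k e) (chartIdeal k he)

section genericPoint

variable {μ : Finset E} {e₀ : E} (he₀ : e₀ ∉ μ)

theorem chart_le_genericPoint : chart k e₀ ≤ (genericPoint k he₀).toSubring :=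
  LocalSubring.le_ofPrime _ _

theorem genericPoint_mem_space : genericPoint k he₀ ∈ space k E :=
  Set.mem_iUnion.2 ⟨e₀, _, inferInstance, rfl⟩

theorem inv_mem_regularRing {b : FunField k E} (hb : b ∈ regularRing k μ)
    (h : restrict k μ ⟨b, hb⟩ ≠ 0) : b⁻¹ ∈ regularRing k μ := by
  obtain ⟨p, q, hq, hpq⟩ := mem_regularRing_iff.1 hb
  have hq0 : algebraMap (MvPolynomial E k) (FunField k E) q ≠ 0 := by
    rw [Ne, FaithfulSMul.algebraMap_eq_zero_iff]
    rintro rfl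
    exact hq (map_zero _)
  refine mem_regularRing_iff.2 ⟨q, p, fun hp => h ?_, by rw [hpq]; simp⟩
  have h1 : restrict k μ ⟨b, hb⟩ * restrict k μ ⟨_, algebraMap_mem_regularRing μ q⟩ =
      restrict k μ ⟨_, algebraMap_mem_regularRing μ p⟩ := by
    rw [← map_mul]
    congr 1
    exact Subtype.ext (by
      change b * algebraMap _ _ q = algebraMap _ _ p
      rw [hpq, inv_mul_cancel_right₀ hq0])
  rw [restrict_algebraMap, restrict_algebraMap, hp, map_zero] at h1
  refine (mul_eq_zero.1 h1).resolve_right fun h2 => hq ?_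
  rwa [FaithfulSMul.algebraMap_eq_zero_iff] at h2

theorem genericPoint_le_regularRing :
    (genericPoint k he₀).toSubring ≤ regularRing k μ := by
  intro r hr
  obtain ⟨a, b, hb, rfl⟩ := (Model.mem_ofPrime_iff _ _ _).1 hr
  rw [div_eq_mul_inv]
  exact Subring.mul_mem _ (chart_le_regularRing he₀ a.2)
    (inv_mem_regularRing (chart_le_regularRing he₀ b.2) hb)

theorem inv_mem_genericPoint {r : FunField k E} (hr : r ∈ (genericPoint k he₀).toSubring)
    (h : restrict k μ ⟨r, genericPoint_le_regularRing he₀ hr⟩ ≠ 0) :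
    r⁻¹ ∈ (genericPoint k he₀).toSubring := by
  obtain ⟨a, b, hb, hab⟩ := (Model.mem_ofPrime_iff _ _ _).1 hr
  have hb0 : (b : FunField k E) ≠ 0 := fun h0 => hb <| by
    rw [show b = 0 from Subtype.ext h0]
    exact Ideal.zero_mem _
  refine (Model.mem_ofPrime_iff _ _ _).2 ⟨b, a, fun ha => ?_, by rw [hab, inv_div]⟩
  have h1 : restrict k μ ⟨r, genericPoint_le_regularRing he₀ hr⟩ *
      restrict k μ ⟨b, chart_le_regularRing he₀ b.2⟩ =
        restrict k μ ⟨a, chart_le_regularRing he₀ a.2⟩ := by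
    rw [← map_mul]
    congr 1
    exact Subtype.ext (by
      change r * b = a
      rw [hab, div_mul_cancel₀ _ hb0])
  exact mul_ne_zero h hb (h1.trans ha)

theorem restrict_eq_zero_of_mem_maxIdeal {r : FunField k E}
    (h : r ∈ Model.maxIdeal (genericPoint k he₀)) :
    restrict k μ ⟨r, genericPoint_le_regularRing he₀ (Model.mem_maxIdeal_iff.1 h).1⟩ = 0 := by
  have h' := Model.mem_maxIdeal_iff.1 h
  by_contra h0
  have := h'.2 (inv_mem_genericPoint he₀ h'.1 h0)
  subst this
  exact h0 (map_zero _)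

theorem mem_maxIdeal_genericPoint {r : FunField k E} (hr : r ∈ (genericPoint k he₀).toSubring)
    (h : restrict k μ ⟨r, genericPoint_le_regularRing he₀ hr⟩ = 0) :
    r ∈ Model.maxIdeal (genericPoint k he₀) := by
  refine Model.mem_maxIdeal_iff.2 ⟨hr, fun hi => ?_⟩
  by_contra h0
  have h1 : restrict k μ ⟨r, genericPoint_le_regularRing he₀ hr⟩ *
      restrict k μ ⟨r⁻¹, genericPoint_le_regularRing he₀ hi⟩ = 1 := by
    rw [← map_mul, ← map_one (restrict k μ)]
    congr 1
    exact Subtype.ext (mul_inv_cancel₀ h0)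
  rw [h, zero_mul] at h1
  exact zero_ne_one h1

theorem coord_div_coord_mem_genericPoint {e : E} (he : e ∉ μ) (f : E) :
    coord k f / coord k e ∈ (genericPoint k he₀).toSubring := by
  rw [← div_div_div_cancel_right₀ (coord_ne_zero (k := k) e₀), div_eq_mul_inv]
  refine Subring.mul_mem _ (chart_le_genericPoint he₀ (coord_div_coord_mem_chart e₀ f)) ?_
  refine inv_mem_genericPoint he₀ (chart_le_genericPoint he₀ (coord_div_coord_mem_chart e₀ e)) ?_
  rw [restrict_coord_div_coord_of_notMem he₀ he]
  exact div_ne_zero (coord_ne_zero e) (coord_ne_zero e₀)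

end genericPoint

/-- A function on a toric chart differs from its restriction to `L_μ` by an element of the ideal
generated by those coordinates of the chart that vanish on `L_μ`. -/
theorem sub_restrict_mem {μ : Finset E} {R : Subring (FunField k E)} {G : Set (FunField k E)}
    (hGR : (Algebra.adjoin k G).toSubring ≤ R) (J : Submodule R (FunField k E))
    (hG : ∀ g ∈ G, ∃ e f, e ∉ μ ∧ g = coord k f / coord k e ∧ (f ∈ μ → g ∈ J))
    {b : FunField k E} (hb : b ∈ Algebra.adjoin k G) :
    ∃ h : b ∈ regularRing k μ,
      restrict k μ ⟨b, h⟩ ∈ Algebra.adjoin k G ∧ b - restrict k μ ⟨b, h⟩ ∈ J := by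
  induction hb using Algebra.adjoin_induction with
  | mem x hx =>
    obtain ⟨e, f, he, rfl, hf⟩ := hG x hx
    refine ⟨coord_div_coord_mem_regularRing he f, ?_⟩
    by_cases hfμ : f ∈ μ
    · rw [restrict_coord_div_coord_of_mem he hfμ]
      exact ⟨zero_mem _, by simpa using hf hfμ⟩
    · rw [restrict_coord_div_coord_of_notMem he hfμ]
      exact ⟨Algebra.subset_adjoin hx, by simp⟩
  | algebraMap c =>
    refine ⟨const_mem_regularRing μ c, ?_⟩
    rw [restrict_const]
    exact ⟨Subalgebra.algebraMap_mem _ c, by simp⟩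
  | add x y _ _ hx hy =>
    obtain ⟨hx, hx1, hx2⟩ := hx
    obtain ⟨hy, hy1, hy2⟩ := hy
    have h := map_add (restrict k μ) ⟨x, hx⟩ ⟨y, hy⟩
    refine ⟨add_mem hx hy, ?_⟩
    rw [show (⟨x + y, add_mem hx hy⟩ : regularRing k μ) = ⟨x, hx⟩ + ⟨y, hy⟩ from rfl, h]
    exact ⟨add_mem hx1 hy1, by rw [add_sub_add_comm]; exact add_mem hx2 hy2⟩
  | mul x y hxG _ hx hy =>
    obtain ⟨hx, hx1, hx2⟩ := hx
    obtain ⟨hy, hy1, hy2⟩ := hy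
    have h := map_mul (restrict k μ) ⟨x, hx⟩ ⟨y, hy⟩
    refine ⟨mul_mem hx hy, ?_⟩
    rw [show (⟨x * y, mul_mem hx hy⟩ : regularRing k μ) = ⟨x, hx⟩ * ⟨y, hy⟩ from rfl, h]
    refine ⟨mul_mem hx1 hy1, ?_⟩
    have e : x * y - restrict k μ ⟨x, hx⟩ * restrict k μ ⟨y, hy⟩ =
        (⟨x, hGR hxG⟩ : R) • (y - restrict k μ ⟨y, hy⟩) +
        (⟨_, hGR hy1⟩ : R) • (x - restrict k μ ⟨x, hx⟩) := by
      simp only [Subring.smul_def, smul_eq_mul]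
      ring
    rw [e]
    exact add_mem (J.smul_mem _ hy2) (J.smul_mem _ hx2)

end Proj

/-! ### Pivots and toric charts -/

namespace Proj

variable {k : Type*} [Field k] {E : Type*}

/-- The index sets of the linear spaces blown up in the first `i` steps, and the set of all edges,
which stands for the empty linear space. -/
def processed [Fintype E] (S : Set (Finset E)) (i : ℕ) : Set (Finset E) :=
  insert Finset.univ {μ | ∃ j < i, μ ∈ stratum S j}

section combinatorics

variable {S : Set (Finset E)} {i j : ℕ} {μ ν : Finset E}

theorem remaining_antitone (S : Set (Finset E)) : Antitone (remaining S) :=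
  antitone_nat_of_succ_le fun _ _ h => h.1

theorem mem_of_mem_stratum (h : μ ∈ stratum S i) : μ ∈ S :=
  remaining_antitone S (Nat.zero_le i) h.1

theorem exists_mem_stratum (h : μ ∈ S) : ∀ i, μ ∉ remaining S i → ∃ j < i, μ ∈ stratum S j
  | 0, h' => absurd h h'
  | i + 1, h' => by
    by_cases hi : μ ∈ remaining S i
    · exact ⟨i, Nat.lt_succ_self i, not_not.1 fun hm => h' ⟨hi, hm⟩⟩
    · obtain ⟨j, hj, hm⟩ := exists_mem_stratum h i hi
      exact ⟨j, hj.trans (Nat.lt_succ_self i), hm⟩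

theorem mem_processed_of_ssubset [Fintype E] (hμ : μ ∈ stratum S i) (hν : ν ∈ insert Finset.univ S)
    (h : μ ⊂ ν) : ν ∈ processed S i := by
  rcases hν with rfl | hν
  · exact Or.inl rfl
  · exact Or.inr (exists_mem_stratum hν i fun h' => h.not_subset (hμ.2 h' h.subset))

theorem not_subset_of_mem_processed [Fintype E] (hS : Finset.univ ∉ S) (hμ : μ ∈ stratum S i)
    (hν : ν ∈ processed S i) : ¬ν ⊆ μ := by
  intro h
  rcases hν with rfl | ⟨j, hj, hν⟩
  · rw [Finset.univ_subset_iff] at h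
    exact hS (h ▸ mem_of_mem_stratum hμ)
  · have := hν.eq_of_le (remaining_antitone S hj.le hμ.1) h
    subst this
    exact (remaining_antitone S hj hμ.1).2 hν

theorem processed_subset [Fintype E] : processed S i ⊆ insert Finset.univ S := by
  rintro ν (rfl | ⟨j, -, hν⟩)
  · exact Or.inl rfl
  · exact Or.inr (mem_of_mem_stratum hν)

variable [DecidableEq E]

theorem union_mem_of_mem [Fintype E] (hU : ∀ μ ∈ S, ∀ ν ∈ S, μ ∪ ν ∈ insert Finset.univ S)
    (hμ : μ ∈ insert Finset.univ S) (hν : ν ∈ insert Finset.univ S) :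
    μ ∪ ν ∈ insert Finset.univ S := by
  rcases hμ with rfl | hμ
  · exact Or.inl (by simp)
  rcases hν with rfl | hν
  · exact Or.inl (by simp)
  exact hU μ hμ ν hν

theorem union_mem_processed [Fintype E] (hS : Finset.univ ∉ S)
    (hU : ∀ μ ∈ S, ∀ ν ∈ S, μ ∪ ν ∈ insert Finset.univ S) (hμ : μ ∈ stratum S i)
    (hν : ν ∈ processed S i) : ν ∪ μ ∈ processed S i := by
  refine mem_processed_of_ssubset hμ
    (union_mem_of_mem hU (processed_subset hν) (Or.inr (mem_of_mem_stratum hμ))) ?_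
  refine LE.le.ssubset_of_not_superset Finset.subset_union_right
    fun h => not_subset_of_mem_processed hS hμ hν (Finset.subset_union_left.trans h)

theorem union_mem_processed_of_ne [Fintype E] (hU : ∀ μ ∈ S, ∀ ν ∈ S, μ ∪ ν ∈ insert Finset.univ S)
    (hμ : μ ∈ stratum S i) (hν : ν ∈ stratum S i) (hne : μ ≠ ν) : μ ∪ ν ∈ processed S i := by
  refine mem_processed_of_ssubset hμ (hU μ (mem_of_mem_stratum hμ) ν (mem_of_mem_stratum hν)) ?_
  refine LE.le.ssubset_of_not_superset Finset.subset_union_left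
    fun h => hne (hν.eq_of_le hμ.1 (Finset.subset_union_right.trans h)).symm

end combinatorics

theorem coord_div_mul_coord_div (e f g : E) :
    coord k f / coord k e * (coord k e / coord k g) = coord k f / coord k g :=
  div_mul_div_cancel₀ (coord_ne_zero e)

theorem mem_zeroLocus_X {e : E} {R : LocalSubring (FunField k E)} :
    R ∈ zeroLocus (MvPolynomial.X e : MvPolynomial E k) ↔ R ∈ space k E ∧
      ∃ f, chart k f ≤ R.toSubring ∧ coord k e / coord k f ∈ Model.maxIdeal R := by
  simp [zeroLocus]

theorem mem_linearSpace {μ : Finset E} {e : E} {R : LocalSubring (FunField k E)}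
    (hR : R ∈ space k E) (he : chart k e ≤ R.toSubring)
    (h : ∀ f ∈ μ, coord k f / coord k e ∈ Model.maxIdeal R) : R ∈ linearSpace k μ :=
  ⟨hR, fun f hf => mem_zeroLocus_X.2 ⟨hR, e, he, h f hf⟩⟩

theorem coord_div_coord_notMem {e f : E} {R : LocalSubring (FunField k E)}
    (h : coord k e / coord k f ∈ Model.maxIdeal R) : coord k f / coord k e ∉ R.toSubring := by
  intro h'
  have := (Model.mem_maxIdeal_iff.1 h).2 (by rwa [inv_div])
  exact div_ne_zero (coord_ne_zero e) (coord_ne_zero f) this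

/-- If `L_ν` has been blown up, then at no point of the strict transform of `L_μ` can a coordinate
`A_e` with `e ∈ μ` divide all the coordinates that vanish on `L_ν`. -/
theorem exists_notMem_of_mem_strictTransformIn [Fintype E] {S : Set (Finset E)} {i : ℕ}
    {M : Set (LocalSubring (FunField k E))} {μ ν : Finset E} {R : LocalSubring (FunField k E)}
    (hR : R ∈ strictTransformIn k S i M (linearSpace k μ)) {e : E} (he : e ∈ μ)
    (hν : ν ∈ processed S i) : ∃ f ∈ ν, coord k f / coord k e ∉ R.toSubring := by
  by_contra! h
  obtain ⟨R', ⟨-, R₀, hR₀, hb, hle⟩, hf⟩ := Model.exists_mem_of_mem_closureIn hR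
    (fun f : ν => coord k (f : E) / coord k e) fun f => h f f.2
  obtain ⟨hsp, e₁, hchart, he₁⟩ := mem_zeroLocus_X.1 (hR₀.2 e he)
  -- The point `R₀` does not lie on `L_ν`, so some coordinate with index in `ν` is invertible there.
  obtain ⟨f, hfν, hfm⟩ : ∃ f ∈ ν, coord k f / coord k e₁ ∉ Model.maxIdeal R₀ := by
    rcases hν with rfl | ⟨j, hj, hν⟩
    · refine ⟨e₁, Finset.mem_univ _, fun h1 => coord_div_coord_notMem h1 ?_⟩
      rw [div_self (coord_ne_zero e₁)]
      exact one_mem _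
    · by_contra! h'
      refine hb (Set.mem_iUnion₂.2 ⟨j, hj, Set.mem_iUnion₂.2 ⟨ν, hν, ?_⟩⟩)
      exact mem_linearSpace hsp hchart h'
  have h1 := hle.1 (Model.inv_mem_of_notMem_maxIdeal
    (hchart (coord_div_coord_mem_chart e₁ f)) hfm)
  rw [inv_div] at h1
  refine coord_div_coord_notMem (Model.maxIdeal_subset_of_le hle he₁) ?_
  rw [← coord_div_mul_coord_div f]
  exact Subring.mul_mem _ h1 (hf ⟨f, hfν⟩)

section genericPoint

variable {S : Set (Finset E)} {i : ℕ} {μ : Finset E} {e₀ : E} (he₀ : e₀ ∉ μ)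

/-- The blow-ups of linear spaces that do not contain `L_μ` do not affect its generic point. -/
theorem genericPoint_mem_iteratedBlowUp [Fintype E] :
    ∀ i, (∀ j < i, ∀ ν ∈ stratum S j, ¬ν ⊆ μ) → genericPoint k he₀ ∈ iteratedBlowUp k S i
  | 0, _ => genericPoint_mem_space he₀
  | i + 1, h => by
    refine Model.mem_blowUp_of_one_mem_stalkIdeal (genericPoint_mem_iteratedBlowUp i
      fun j hj => h j (hj.trans (Nat.lt_succ_self i))) ⟨one_mem _, fun R hR hle => ?_⟩
    obtain ⟨ν, hν, hR⟩ := Set.mem_iUnion₂.1 hR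
    obtain ⟨e, heν, heμ⟩ := Finset.not_subset.1 (h i (Nat.lt_succ_self i) ν hν)
    obtain ⟨f, -, hf⟩ := exists_notMem_of_mem_strictTransformIn hR heν (Or.inl rfl)
    exact absurd (hle (coord_div_coord_mem_genericPoint he₀ heμ f)) hf

theorem genericPoint_mem_strictTransformIn [Fintype E] (hS : Finset.univ ∉ S)
    (hμ : μ ∈ stratum S i) :
    genericPoint k he₀ ∈ strictTransformIn k S i (iteratedBlowUp k S i) (linearSpace k μ) := by
  have hsub : ∀ j < i, ∀ ν ∈ stratum S j, ¬ν ⊆ μ := fun j hj ν hν =>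
    not_subset_of_mem_processed hS hμ (Or.inr ⟨j, hj, hν⟩)
  have hM := genericPoint_mem_iteratedBlowUp (k := k) he₀ i hsub
  refine Model.mem_closureIn_of_mem hM ⟨hM, _, ?_, fun hb => ?_, le_rfl⟩
  · refine mem_linearSpace (genericPoint_mem_space he₀) (chart_le_genericPoint he₀) fun f hf => ?_
    exact mem_maxIdeal_genericPoint he₀
      (chart_le_genericPoint he₀ (coord_div_coord_mem_chart e₀ f))
      (restrict_coord_div_coord_of_mem he₀ hf)
  · obtain ⟨j, hj, hb⟩ := Set.mem_iUnion₂.1 hb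
    obtain ⟨ν, hν, hb⟩ := Set.mem_iUnion₂.1 hb
    obtain ⟨e, heν, heμ⟩ := Finset.not_subset.1 (hsub j hj ν hν)
    obtain ⟨-, e₁, -, he₁⟩ := mem_zeroLocus_X.1 (hb.2 e heν)
    exact coord_div_coord_notMem he₁ (coord_div_coord_mem_genericPoint he₀ heμ e₁)

end genericPoint

/-- `A_e` generates the ideal of the coordinates `A_f`, `f ∈ ν`, over the ring `R`. -/
def IsPivot (R : Subring (FunField k E)) (ν : Finset E) (e : E) : Prop :=
  e ∈ ν ∧ ∀ f ∈ ν, coord k f / coord k e ∈ R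

section IsPivot

variable {R R' : Subring (FunField k E)} {μ ν : Finset E} {e f : E}

theorem IsPivot.mono (h : IsPivot R ν e) (hle : R ≤ R') : IsPivot R' ν e :=
  ⟨h.1, fun f hf => hle (h.2 f hf)⟩

theorem IsPivot.subset (h : IsPivot R ν e) (hle : μ ⊆ ν) (he : e ∈ μ) : IsPivot R μ e :=
  ⟨he, fun f hf => h.2 f (hle hf)⟩

theorem IsPivot.of_div_mem (h : IsPivot R ν e) (hf : f ∈ ν) (hef : coord k e / coord k f ∈ R) :
    IsPivot R ν f :=
  ⟨hf, fun g hg => coord_div_mul_coord_div (k := k) e g f ▸ R.mul_mem (h.2 g hg) hef⟩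

/-- If some pivot of `ν` lies in the subset `μ`, then every pivot of `μ` is a pivot of `ν`. -/
theorem IsPivot.of_subset (h : IsPivot R μ f) (h' : IsPivot R ν e) (hle : μ ⊆ ν) (he : e ∈ μ) :
    IsPivot R ν f :=
  h'.of_div_mem (hle h.1) (h.2 e he)

end IsPivot

variable (k) in
/-- The coordinate ring of the toric chart of the `i`-th blow-up that contains the point `R`: it is
generated by the quotients `A_f / A_e` with `f ∈ ν`, for the `ν` processed so far and the pivots
`e` of `ν` at `R`. -/
noncomputable def toricChart [Fintype E] (S : Set (Finset E)) (i : ℕ) (R : Subring (FunField k E)) :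
    Subalgebra k (FunField k E) :=
  Algebra.adjoin k {g | ∃ ν ∈ processed S i, ∃ e f, IsPivot R ν e ∧ f ∈ ν ∧
    g = coord k f / coord k e}

section toricChart

variable {S : Set (Finset E)} {i j : ℕ} {R R' : Subring (FunField k E)}

theorem div_mem_toricChart [Fintype E] {ν : Finset E} {e f : E} (hν : ν ∈ processed S i)
    (he : IsPivot R ν e) (hf : f ∈ ν) : coord k f / coord k e ∈ toricChart k S i R :=
  Algebra.subset_adjoin ⟨ν, hν, e, f, he, hf, rfl⟩

theorem toricChart_le [Fintype E] (hc : ∀ c : k, algebraMap k (FunField k E) c ∈ R) :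
    (toricChart k S i R).toSubring ≤ R :=
  adjoin_toSubring_le hc (by rintro _ ⟨ν, -, e, f, he, hf, rfl⟩; exact he.2 f hf)

theorem processed_mono [Fintype E] (S : Set (Finset E)) : Monotone (processed S) := fun _ _ hij =>
  Set.insert_subset_insert fun _ ⟨j, hj, h⟩ => ⟨j, hj.trans_le hij, h⟩

theorem toricChart_mono [Fintype E] (hij : i ≤ j) (hle : R ≤ R') :
    toricChart k S i R ≤ toricChart k S j R' :=
  Algebra.adjoin_mono (by
    rintro _ ⟨ν, hν, e, f, he, hf, rfl⟩
    exact ⟨ν, processed_mono S hij hν, e, f, he.mono hle, hf, rfl⟩)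

end toricChart

/-- The local structure of the iterated blow-up at the point `R` after `i` steps: the ideals of the
linear spaces blown up so far are principal, and `R` is a localization of its toric chart. -/
structure IsToricPoint [Fintype E] (S : Set (Finset E)) (i : ℕ) (R : LocalSubring (FunField k E)) :
    Prop where
  exists_isPivot : ∀ ν ∈ processed S i, ∃ e, IsPivot R.toSubring ν e
  algebraMap_mem : ∀ c : k, algebraMap k (FunField k E) c ∈ R.toSubring
  le_fractionsIn : R.toSubring ≤
    Model.fractionsIn (toricChart k S i R.toSubring).toSubring R.toSubring

theorem isToricPoint_zero [Fintype E] {S : Set (Finset E)} {R : LocalSubring (FunField k E)}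
    (hR : R ∈ space k E) : IsToricPoint S 0 R := by
  obtain ⟨e, hR⟩ := Set.mem_iUnion.1 hR
  have hle := Model.le_of_mem_spec hR
  have he : IsPivot R.toSubring Finset.univ e :=
    ⟨Finset.mem_univ e, fun f _ => hle (coord_div_coord_mem_chart e f)⟩
  refine ⟨?_, fun c => hle (algebraMap_mem_chart e c), ?_⟩
  · rintro ν (rfl | ⟨j, hj, -⟩)
    · exact ⟨e, he⟩
    · exact absurd hj (Nat.not_lt_zero j)
  · refine Model.le_fractionsIn_of_mem_spec hR
      ((chart_le (fun c => ?_) fun f => ?_).trans Model.le_fractionsIn)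
    · exact Subalgebra.algebraMap_mem _ c
    · exact div_mem_toricChart (Or.inl rfl) he (Finset.mem_univ f)

end Proj

/-! ### The local structure of the iterated blow-up -/

namespace Proj

variable {k : Type*} [Field k] {E : Type*} [Fintype E]

section step

variable {S : Set (Finset E)} {i : ℕ} {R : LocalSubring (FunField k E)} {μ : Finset E}

/-- Among the pivots of the processed sets containing `μ` there is one that is divisible by all the
others. -/
theorem IsToricPoint.exists_last_pivot [DecidableEq E]
    (hU : ∀ μ ∈ S, ∀ ν ∈ S, μ ∪ ν ∈ insert Finset.univ S) (hR : IsToricPoint S i R)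
    (hS : Finset.univ ∉ S) (hμ : μ ∈ stratum S i) :
    ∃ ν ∈ processed S i, μ ⊆ ν ∧ ∃ x, IsPivot R.toSubring ν x ∧
      ∀ ν' ∈ processed S i, μ ⊆ ν' → ∀ e, IsPivot R.toSubring ν' e →
        coord k x / coord k e ∈ R.toSubring := by
  let I := {ν : Finset E // ν ∈ processed S i ∧ μ ⊆ ν}
  choose p hp using fun ν : I => hR.exists_isPivot ν.1 ν.2.1
  let r : E → E → Prop := fun e f => coord k f / coord k e ∈ R.toSubring
  have : IsTrans E r := ⟨fun a b c hab hbc => by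
    change coord k c / coord k a ∈ R.toSubring
    rw [← coord_div_mul_coord_div b]
    exact R.toSubring.mul_mem hbc hab⟩
  have : Nonempty I := ⟨⟨Finset.univ, Or.inl rfl, Finset.subset_univ μ⟩⟩
  have htotal : Directed r p := by
    intro ν₁ ν₂
    have hν : ν₁.1 ∪ ν₂.1 ∈ processed S i := by
      refine mem_processed_of_ssubset hμ
        (union_mem_of_mem hU (processed_subset ν₁.2.1) (processed_subset ν₂.2.1)) ?_
      exact LE.le.ssubset_of_not_superset (ν₁.2.2.trans Finset.subset_union_left)
        fun h => not_subset_of_mem_processed hS hμ ν₁.2.1 (Finset.subset_union_left.trans h)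
    obtain ⟨e, he⟩ := hR.exists_isPivot _ hν
    have hrefl : ∀ ν : I, r (p ν) (p ν) := fun ν => (hp ν).2 _ (hp ν).1
    rcases Finset.mem_union.1 he.1 with h | h
    · exact ⟨ν₂, ((hp ν₁).of_subset he Finset.subset_union_left h).2 _
        (Finset.mem_union_right _ (hp ν₂).1), hrefl ν₂⟩
    · exact ⟨ν₁, hrefl ν₁, ((hp ν₂).of_subset he Finset.subset_union_right h).2 _
        (Finset.mem_union_left _ (hp ν₁).1)⟩
  obtain ⟨ν, hν⟩ := htotal.finite_le (id : I → I)
  refine ⟨ν.1, ν.2.1, ν.2.2, p ν, hp ν, fun ν' hν' hμν' e he => ?_⟩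
  rw [← coord_div_mul_coord_div (p ⟨ν', hν', hμν'⟩)]
  exact R.toSubring.mul_mem (hν ⟨ν', hν', hμν'⟩) (he.2 _ (hp _).1)

/-- If no pivot of a processed set containing `μ` lies in `μ`, then the next blow-up takes place
at `R` along the strict transform of `L_μ`, whose ideal is generated by the quotients `A_f / A_x`
with `f ∈ μ`, for some pivot `x`. -/
theorem IsToricPoint.exists_span_eq_stalkIdeal [DecidableEq E]
    (hU : ∀ μ ∈ S, ∀ ν ∈ S, μ ∪ ν ∈ insert Finset.univ S) (hR : IsToricPoint S i R)
    (hS : Finset.univ ∉ S) (hμ : μ ∈ stratum S i)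
    (hpiv : ∀ ν ∈ processed S i, μ ⊆ ν → ∀ e, IsPivot R.toSubring ν e → e ∉ μ) :
    ∃ x, (Submodule.span R.toSubring {g | ∃ f ∈ μ, g = coord k f / coord k x} : Set _) =
      Model.stalkIdeal (⋃ μ ∈ stratum S i,
        strictTransformIn k S i (iteratedBlowUp k S i) (linearSpace k μ)) R := by
  -- A pivot of `ν` is even a pivot of `ν ∪ μ`, since a pivot of the union cannot lie in `μ`.
  have hunion : ∀ ν ∈ processed S i, ∀ e, IsPivot R.toSubring ν e →
      IsPivot R.toSubring (ν ∪ μ) e ∧ e ∉ μ := by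
    intro ν hν e he
    have hνμ := union_mem_processed hS hU hμ hν
    obtain ⟨e', he'⟩ := hR.exists_isPivot _ hνμ
    have h := (Finset.mem_union.1 he'.1).resolve_right
      (hpiv _ hνμ Finset.subset_union_right e' he')
    have h' := he.of_subset he' Finset.subset_union_left h
    exact ⟨h', hpiv _ hνμ Finset.subset_union_right e h'⟩
  obtain ⟨ν₀, hν₀, hμν₀, x, hx, hlast⟩ := hR.exists_last_pivot hU hS hμ
  refine ⟨x, ?_⟩
  set J := Submodule.span R.toSubring {g | ∃ f ∈ μ, g = coord k f / coord k x} with hJ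
  have hJmax : (J : Set (FunField k E)) ⊆ Model.maxIdeal R := by
    intro a ha
    induction ha using Submodule.span_induction with
    | mem a ha =>
      obtain ⟨f, hf, rfl⟩ := ha
      refine Model.mem_maxIdeal_iff.2 ⟨hx.2 f (hμν₀ hf), fun h => ?_⟩
      rw [inv_div] at h
      exact absurd hf (hpiv ν₀ hν₀ hμν₀ f (hx.of_div_mem (hμν₀ hf) h))
    | zero => exact Model.zero_mem_maxIdeal R
    | add a b _ _ ha hb => exact Model.add_mem_maxIdeal ha hb
    | smul r a _ ha => exact Model.mul_mem_maxIdeal r.2 ha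
  obtain ⟨e₀, -, he₀⟩ : ∃ e₀ ∈ Finset.univ, e₀ ∉ μ := Finset.not_subset.1 fun h =>
    not_subset_of_mem_processed hS hμ (Or.inl rfl) h
  have hBR : (toricChart k S i R.toSubring).toSubring ≤ R.toSubring :=
    toricChart_le hR.algebraMap_mem
  -- A generator of the toric chart that vanishes on `L_μ` is a multiple of some `A_f / A_x`, as
  -- `A_x` is divisible by the pivot in the denominator.
  have hred : ∀ b ∈ toricChart k S i R.toSubring, ∃ h : b ∈ regularRing k μ,
      restrict k μ ⟨b, h⟩ ∈ toricChart k S i R.toSubring ∧ b - restrict k μ ⟨b, h⟩ ∈ J := by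
    refine fun b hb => sub_restrict_mem hBR J ?_ hb
    rintro _ ⟨ν, hν, e, f, he, -, rfl⟩
    refine ⟨e, f, (hunion ν hν e he).2, rfl, fun hf => ?_⟩
    have h := hlast _ (union_mem_processed hS hU hμ hν) Finset.subset_union_right e
      (hunion ν hν e he).1
    have hmem : (⟨_, h⟩ : R.toSubring) • (coord k f / coord k x) ∈ J :=
      J.smul_mem _ (Submodule.subset_span ⟨f, hf, rfl⟩)
    rwa [Subring.smul_def, smul_eq_mul, mul_comm, coord_div_mul_coord_div] at hmem
  have hBG : (toricChart k S i R.toSubring).toSubring ≤ (genericPoint k he₀).toSubring := by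
    refine adjoin_toSubring_le
      (fun c => chart_le_genericPoint he₀ (algebraMap_mem_chart e₀ c)) ?_
    rintro _ ⟨ν, hν, e, f, he, -, rfl⟩
    exact coord_div_coord_mem_genericPoint he₀ (hunion ν hν e he).2 f
  have hzero : ∀ b ∈ toricChart k S i R.toSubring,
      ∀ h : b ∈ regularRing k μ, restrict k μ ⟨b, h⟩ = 0 → b ∈ J := by
    intro b hb h h0
    obtain ⟨h, -, hJ⟩ := hred b hb
    rwa [h0, sub_zero] at hJ
  -- Denominators outside the maximal ideal of `R` do not vanish on `L_μ`, so `R` specializes the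
  -- generic point of `L_μ`.
  have hRG : R.toSubring ≤ (genericPoint k he₀).toSubring := by
    intro r hr
    obtain ⟨a, ha, b, hb, hb0, hbi, rfl⟩ := hR.le_fractionsIn hr
    rw [div_eq_mul_inv]
    refine Subring.mul_mem _ (hBG ha) (inv_mem_genericPoint he₀ (hBG hb) fun h0 => hb0 ?_)
    exact (Model.mem_maxIdeal_iff.1 (hJmax (hzero b hb _ h0))).2 hbi
  apply Set.Subset.antisymm
  · intro a ha
    refine ⟨(Model.mem_maxIdeal_iff.1 (hJmax ha)).1, fun S' hS' hle => ?_⟩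
    obtain ⟨μ', hμ', hS'⟩ := Set.mem_iUnion₂.1 hS'
    induction ha using Submodule.span_induction with
    | mem a ha =>
      obtain ⟨f, hf, rfl⟩ := ha
      rcases eq_or_ne μ μ' with rfl | hne
      · refine Model.mem_maxIdeal_iff.2 ⟨hle (hx.2 f (hμν₀ hf)), fun h => ?_⟩
        rw [inv_div] at h
        obtain ⟨f', hf', hn⟩ := exists_notMem_of_mem_strictTransformIn hS' hf hν₀
        refine absurd ?_ hn
        rw [← coord_div_mul_coord_div x]
        exact S'.toSubring.mul_mem (hle (hx.2 f' hf')) h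
      · -- The strict transforms of two members of a stratum are disjoint.
        have hν := union_mem_processed_of_ne hU hμ hμ' hne
        obtain ⟨e, he⟩ := hR.exists_isPivot _ hν
        have heμ' := (Finset.mem_union.1 he.1).resolve_left
          (hpiv _ hν Finset.subset_union_left e he)
        obtain ⟨f', hf', hn⟩ := exists_notMem_of_mem_strictTransformIn hS' heμ' hν
        exact absurd (hle (he.2 f' hf')) hn
    | zero => exact Model.zero_mem_maxIdeal S'
    | add a b _ _ ha hb => exact Model.add_mem_maxIdeal ha hb
    | smul r a _ ha => exact Model.mul_mem_maxIdeal (hle r.2) ha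
  · -- An element of the stalk vanishes at the generic point of `L_μ`, hence so does its numerator.
    rintro a ⟨haR, ha⟩
    have haG := ha _ (Set.mem_iUnion₂.2 ⟨μ, hμ, genericPoint_mem_strictTransformIn he₀ hS hμ⟩) hRG
    obtain ⟨p, hp, q, hq, hq0, hqi, rfl⟩ := hR.le_fractionsIn haR
    have hpG := Model.mul_mem_maxIdeal (hBG hq) haG
    rw [mul_div_cancel₀ _ hq0] at hpG
    have hpJ : (⟨q⁻¹, hqi⟩ : R.toSubring) • p ∈ J :=
      J.smul_mem _ (hzero p hp _ (restrict_eq_zero_of_mem_maxIdeal he₀ hpG))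
    rwa [Subring.smul_def, smul_eq_mul, inv_mul_eq_div] at hpJ

/-- The local structure of the iterated blow-up is inherited by the next blow-up. -/
theorem IsToricPoint.succ [DecidableEq E] (hU : ∀ μ ∈ S, ∀ ν ∈ S, μ ∪ ν ∈ insert Finset.univ S)
    (hS : Finset.univ ∉ S) (hR : IsToricPoint S i R) {R' : LocalSubring (FunField k E)}
    {g : FunField k E} {Z : Set (LocalSubring (FunField k E))}
    (hZ : Z = ⋃ μ ∈ stratum S i,
      strictTransformIn k S i (iteratedBlowUp k S i) (linearSpace k μ))
    (hg : g ∈ Model.stalkIdeal Z R) (hg0 : g ≠ 0) (hle : R ≤ R')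
    (hR' : R' ∈ Model.spec (Subring.closure ((R.toSubring : Set (FunField k E)) ∪
      {b | ∃ a ∈ Model.stalkIdeal Z R, b = a / g}))) :
    IsToricPoint S (i + 1) R' := by
  have hle' : R.toSubring ≤ R'.toSubring := hle.1
  have hdiv : ∀ a ∈ Model.stalkIdeal Z R, a / g ∈ R'.toSubring := fun a ha =>
    Model.le_of_mem_spec hR' (Subring.subset_closure (Or.inr ⟨a, ha, rfl⟩))
  have hc : ∀ c : k, algebraMap k (FunField k E) c ∈ R'.toSubring := fun c =>
    hle' (hR.algebraMap_mem c)
  have hfrac : R.toSubring ≤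
      Model.fractionsIn (toricChart k S (i + 1) R'.toSubring).toSubring R'.toSubring := by
    intro r hr
    obtain ⟨a, ha, b, hb, hb0, hbi, rfl⟩ := hR.le_fractionsIn hr
    have hmono := toricChart_mono (k := k) (S := S) (Nat.le_succ i) hle'
    exact ⟨a, hmono ha, b, hmono hb, hb0, hle' hbi, rfl⟩
  -- It remains to find pivots for the new stratum, and to write the new functions as fractions.
  suffices h : (∀ μ ∈ stratum S i, ∃ e, IsPivot R'.toSubring μ e) ∧
      ∀ a ∈ Model.stalkIdeal Z R, a / g ∈
        Model.fractionsIn (toricChart k S (i + 1) R'.toSubring).toSubring R'.toSubring by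
    refine ⟨?_, hc, Model.le_fractionsIn_of_mem_spec hR' (Subring.closure_le.2 ?_)⟩
    · rintro ν (rfl | ⟨j, hj, hν⟩)
      · exact (hR.exists_isPivot _ (Or.inl rfl)).imp fun _ he => he.mono hle'
      · rcases Nat.lt_succ_iff_lt_or_eq.1 hj with hj | rfl
        · exact (hR.exists_isPivot ν (Or.inr ⟨j, hj, hν⟩)).imp fun _ he => he.mono hle'
        · exact h.1 ν hν
    · rintro b (hb | ⟨a, ha, rfl⟩)
      · exact hfrac hb
      · exact h.2 a ha
  by_cases hcase : ∃ μ ∈ stratum S i, ∀ ν ∈ processed S i, μ ⊆ ν →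
      ∀ e, IsPivot R.toSubring ν e → e ∉ μ
  · obtain ⟨μ, hμ, hpiv⟩ := hcase
    obtain ⟨x, hJ⟩ := hR.exists_span_eq_stalkIdeal hU hS hμ hpiv
    rw [← hZ] at hJ
    have hgen : ∀ f ∈ μ, coord k f / coord k x / g ∈ R'.toSubring := fun f hf =>
      hdiv _ (hJ ▸ Submodule.subset_span ⟨f, hf, rfl⟩)
    have hspan : ∀ a ∈ Model.stalkIdeal Z R,
        a ∈ Submodule.span R.toSubring {g | ∃ f ∈ μ, g = coord k f / coord k x} :=
      fun a ha => by rwa [← hJ] at ha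
    -- One of the generators of the ideal generates it after the blow-up, since `g` does.
    obtain ⟨e, heμ, he⟩ : ∃ e ∈ μ, coord k e / coord k x / g ∉ Model.maxIdeal R' := by
      by_contra! hall
      have hmax : ∀ a ∈ Model.stalkIdeal Z R, a / g ∈ Model.maxIdeal R' := by
        refine fun a ha => ?_
        replace ha := hspan a ha
        induction ha using Submodule.span_induction with
        | mem a ha => obtain ⟨f, hf, rfl⟩ := ha; exact hall f hf
        | zero => simpa using Model.zero_mem_maxIdeal R'
        | add a b ha hb iha ihb =>
          rw [add_div]
          exact Model.add_mem_maxIdeal iha ihb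
        | smul r a ha iha =>
          rw [Subring.smul_def, smul_eq_mul, mul_div_assoc]
          exact Model.mul_mem_maxIdeal (hle' r.2) iha
      have h1 := Model.mem_maxIdeal_iff.1 (hmax g hg)
      rw [div_self hg0, inv_one] at h1
      exact one_ne_zero (h1.2 (one_mem _))
    have hu := Model.inv_mem_of_notMem_maxIdeal (hgen e heμ) he
    have hx0 := coord_ne_zero (k := k) x
    have he0 := coord_ne_zero (k := k) e
    have heP : IsPivot R'.toSubring μ e := by
      refine ⟨heμ, fun f hf => ?_⟩
      have : coord k f / coord k e =
          coord k f / coord k x / g * (coord k e / coord k x / g)⁻¹ := by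
        field_simp
      rw [this]
      exact Subring.mul_mem _ (hgen f hf) hu
    have hμ' : μ ∈ processed S (i + 1) := Or.inr ⟨i, Nat.lt_succ_self i, hμ⟩
    refine ⟨fun μ' hμ'' => ?_, fun a ha => ?_⟩
    · rcases eq_or_ne μ μ' with rfl | hne
      · exact ⟨e, heP⟩
      · have hν := union_mem_processed_of_ne hU hμ hμ'' hne
        obtain ⟨f, hf⟩ := hR.exists_isPivot _ hν
        have hfμ' := (Finset.mem_union.1 hf.1).resolve_left
          (hpiv _ hν Finset.subset_union_left f hf)
        exact ⟨f, (hf.subset Finset.subset_union_right hfμ').mono hle'⟩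
    · -- Relative to the generator `A_e / A_x`, the ideal consists of fractions.
      have hrel : ∀ a ∈ Model.stalkIdeal Z R, a / (coord k e / coord k x) ∈
          Model.fractionsIn (toricChart k S (i + 1) R'.toSubring).toSubring R'.toSubring := by
        refine fun a ha => ?_
        replace ha := hspan a ha
        induction ha using Submodule.span_induction with
        | mem a ha =>
          obtain ⟨f, hf, rfl⟩ := ha
          rw [div_div_div_cancel_right₀ hx0]
          exact Model.le_fractionsIn (div_mem_toricChart hμ' heP hf)
        | zero => simp
        | add a b ha hb iha ihb =>
          rw [add_div]
          exact Subring.add_mem _ iha ihb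
        | smul r a ha iha =>
          rw [Subring.smul_def, smul_eq_mul, mul_div_assoc]
          exact Subring.mul_mem _ (hfrac r.2) iha
      have hgi := Model.inv_mem_fractionsIn (hrel g hg) (by rw [inv_div]; exact hgen e heμ)
      have : a / g = a / (coord k e / coord k x) * (g / (coord k e / coord k x))⁻¹ := by
        field_simp
      rw [this]
      exact Subring.mul_mem _ (hrel a ha) hgi
  · -- The point `R` does not lie on the centre of the blow-up.
    push Not at hcase
    have h1 : (1 : FunField k E) ∈ Model.stalkIdeal Z R := by
      refine ⟨one_mem _, fun S' hS' hRS' => ?_⟩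
      rw [hZ] at hS'
      obtain ⟨μ, hμ, hS'⟩ := Set.mem_iUnion₂.1 hS'
      obtain ⟨ν, hν, -, e, he, heμ⟩ := hcase μ hμ
      obtain ⟨f, hf, hn⟩ := exists_notMem_of_mem_strictTransformIn hS' heμ hν
      exact absurd (hRS' (he.2 f hf)) hn
    have hgi := hdiv 1 h1
    refine ⟨fun μ hμ => ?_, fun a ha => ?_⟩
    · obtain ⟨ν, hν, hμν, e, he, heμ⟩ := hcase μ hμ
      exact ⟨e, (he.subset hμν heμ).mono hle'⟩
    · rw [div_eq_mul_inv]
      rw [one_div] at hgi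
      exact Subring.mul_mem _ (hfrac ha.1) (Model.inv_mem_fractionsIn (hfrac hg.1) hgi)

end step

theorem isToricPoint_of_mem_iteratedBlowUp [DecidableEq E] {S : Set (Finset E)}
    (hU : ∀ μ ∈ S, ∀ ν ∈ S, μ ∪ ν ∈ insert Finset.univ S)
    (hS : Finset.univ ∉ S) :
    ∀ (i : ℕ) (R : LocalSubring (FunField k E)), R ∈ iteratedBlowUp k S i → IsToricPoint S i R
  | 0, _, hR => isToricPoint_zero hR
  | i + 1, _, ⟨R, hR, _, hg, hg0, hle, hspec⟩ =>
    (isToricPoint_of_mem_iteratedBlowUp hU hS i R hR).succ hU hS rfl hg hg0 hle hspec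

/-- On the complete iterated blow-up, the ideals of all the linear spaces are principal. -/
theorem exists_isPivot_of_mem_iteratedBlowUp [DecidableEq E] {S : Set (Finset E)}
    (hU : ∀ μ ∈ S, ∀ ν ∈ S, μ ∪ ν ∈ insert Finset.univ S)
    (hS : Finset.univ ∉ S) {R : LocalSubring (FunField k E)}
    (hR : R ∈ iteratedBlowUp k S (Fintype.card E)) {ν : Finset E}
    (hν : ν ∈ insert Finset.univ S) : ∃ e, IsPivot R.toSubring ν e := by
  refine (isToricPoint_of_mem_iteratedBlowUp hU hS _ R hR).exists_isPivot ν ?_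
  rcases hν with rfl | hν
  · exact Or.inl rfl
  · refine Or.inr (exists_mem_stratum hν _ ?_)
    rw [remaining_card hS]
    exact Set.notMem_empty ν

end Proj

/-! ### Cycles and core subgraphs -/

namespace FeynmanGraph

variable {H V E : Type*} [Fintype H] (Γ : FeynmanGraph H V E)

section homology

variable {Γ} {γ δ D : Finset E} {c : H → ℚ} {e : E} {h h' : H}

theorem firstHomology_mono (hle : γ ⊆ δ) : Γ.firstHomology γ ≤ Γ.firstHomology δ :=
  fun _ hc => ⟨fun h hh => hc.1 h fun hγ => hh (hle hγ), hc.2⟩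

theorem loopNumber_mono (hle : γ ⊆ δ) : Γ.loopNumber γ ≤ Γ.loopNumber δ :=
  Submodule.finrank_mono (firstHomology_mono hle)

theorem loopNumber_eq_zero_iff : Γ.loopNumber γ = 0 ↔ Γ.firstHomology γ = ⊥ :=
  Submodule.finrank_eq_zero

open scoped Classical in
theorem mem_firstHomology_sdiff (hc : c ∈ Γ.firstHomology γ)
    (hD : ∀ h, Γ.edge h ∈ D → c h = 0) : c ∈ Γ.firstHomology (γ \ D) := by
  refine ⟨fun h hh => ?_, hc.2⟩
  by_cases hh' : Γ.edge h ∈ D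
  · exact hD h hh'
  · exact hc.1 h fun hγ => hh (Finset.mem_sdiff.2 ⟨hγ, hh'⟩)

open scoped Classical in
theorem filter_edge_eq_pair (hne : h ≠ h') (he : Γ.edge h = Γ.edge h') :
    (Finset.univ.filter fun x => Γ.edge x = Γ.edge h) = {h, h'} := by
  refine (Finset.eq_of_subset_of_card_le ?_ ?_).symm
  · intro x hx
    rcases Finset.mem_insert.1 hx with rfl | hx
    · simp
    · simp [Finset.mem_singleton.1 hx, he]
  · rw [Finset.card_pair hne]
    exact Γ.card_fiber_le _

open scoped Classical in
/-- A cycle runs through both halves of an edge, in opposite directions. -/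
theorem add_apply_eq_zero (hc : c ∈ Γ.firstHomology γ) (hne : h ≠ h')
    (he : Γ.edge h = Γ.edge h') : c h + c h' = 0 := by
  have := hc.2.2 (Γ.edge h)
  rwa [filter_edge_eq_pair hne he, Finset.sum_pair hne] at this

theorem apply_eq_zero_of_edge_eq (hc : c ∈ Γ.firstHomology γ) (he : Γ.edge h = Γ.edge h')
    (h0 : c h = 0) : c h' = 0 := by
  rcases eq_or_ne h h' with rfl | hne
  · exact h0
  · simpa [h0] using add_apply_eq_zero hc hne he

variable (Γ) in
/-- Some cycle of the subgraph with edge set `γ` runs through the edge `e`. -/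
def OnCycle (γ : Finset E) (e : E) : Prop :=
  ∃ c ∈ Γ.firstHomology γ, ∃ h, Γ.edge h = e ∧ c h ≠ 0

theorem OnCycle.mono (h : Γ.OnCycle γ e) (hle : γ ⊆ δ) : Γ.OnCycle δ e :=
  let ⟨c, hc, h⟩ := h
  ⟨c, firstHomology_mono hle hc, h⟩

theorem OnCycle.mem (h : Γ.OnCycle γ e) : e ∈ γ := by
  obtain ⟨c, hc, h, rfl, hne⟩ := h
  by_contra hh
  exact hne (hc.1 h hh)

open scoped Classical in
theorem firstHomology_sdiff_eq (hD : ∀ e ∈ D, ¬Γ.OnCycle γ e) :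
    Γ.firstHomology (γ \ D) = Γ.firstHomology γ := by
  refine le_antisymm (firstHomology_mono Finset.sdiff_subset) fun c hc => ?_
  refine mem_firstHomology_sdiff hc fun h hh => ?_
  by_contra h0
  exact hD _ hh ⟨c, hc, h, rfl, h0⟩

open scoped Classical in
theorem loopNumber_erase_lt_iff :
    Γ.loopNumber (γ.erase e) < Γ.loopNumber γ ↔ Γ.OnCycle γ e := by
  constructor
  · intro hlt
    by_contra hn
    refine hlt.ne ?_
    rw [Finset.erase_eq, loopNumber, loopNumber, firstHomology_sdiff_eq (by simpa using hn)]
  · rintro ⟨c, hc, h, rfl, h0⟩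
    refine Submodule.finrank_lt_finrank_of_lt
      (lt_of_le_of_ne (firstHomology_mono (Finset.erase_subset _ _)) fun heq => h0 ?_)
    rw [← heq] at hc
    exact hc.1 h (Finset.notMem_erase _ _)

theorem isCoreSubgraph_iff : Γ.IsCoreSubgraph γ ↔ ∀ e ∈ γ, Γ.OnCycle γ e :=
  forall₂_congr fun _ _ => loopNumber_erase_lt_iff

theorem IsCoreSubgraph.union [DecidableEq E] (hγ : Γ.IsCoreSubgraph γ)
    (hδ : Γ.IsCoreSubgraph δ) : Γ.IsCoreSubgraph (γ ∪ δ) := by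
  rw [isCoreSubgraph_iff] at *
  intro e he
  rcases Finset.mem_union.1 he with he | he
  · exact (hγ e he).mono Finset.subset_union_left
  · exact (hδ e he).mono Finset.subset_union_right

open scoped Classical in
/-- The edges on cycles form a core subgraph. -/
theorem isCoreSubgraph_filter (γ : Finset E) :
    Γ.IsCoreSubgraph (γ.filter fun e => Γ.OnCycle γ e) := by
  rw [isCoreSubgraph_iff]
  intro e he
  obtain ⟨c, hc, h, rfl, h0⟩ := (Finset.mem_filter.1 he).2
  refine ⟨c, ⟨fun h' hh' => ?_, hc.2⟩, h, rfl, h0⟩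
  by_contra h0'
  have hon : Γ.OnCycle γ (Γ.edge h') := ⟨c, hc, h', rfl, h0'⟩
  exact hh' (Finset.mem_filter.2 ⟨hon.mem, hon⟩)

theorem exists_onCycle (h0 : Γ.loopNumber γ ≠ 0) : ∃ e, Γ.OnCycle γ e := by
  rw [Ne, loopNumber_eq_zero_iff] at h0
  obtain ⟨c, hc, hc0⟩ := Submodule.exists_mem_ne_zero_of_ne_bot h0
  obtain ⟨h, hh⟩ := Function.ne_iff.1 hc0
  exact ⟨_, c, hc, h, rfl, hh⟩

open scoped Classical in
theorem loopNumber_le_erase_add_one (γ : Finset E) (e : E) :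
    Γ.loopNumber γ ≤ Γ.loopNumber (γ.erase e) + 1 := by
  obtain ⟨h, rfl⟩ := Γ.edge_surjective e
  let f : Γ.firstHomology γ →ₗ[ℚ] ℚ := (LinearMap.proj h).domRestrict (Γ.firstHomology γ)
  have h1 := LinearMap.finrank_range_add_finrank_ker f
  have h2 : Module.finrank ℚ (LinearMap.range f) ≤ 1 :=
    (Submodule.finrank_le _).trans (Module.finrank_self ℚ).le
  have h3 : (LinearMap.ker f).map (Γ.firstHomology γ).subtype ≤
      Γ.firstHomology (γ.erase (Γ.edge h)) := by
    rintro _ ⟨⟨c, hc⟩, hker, rfl⟩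
    rw [Finset.erase_eq]
    refine mem_firstHomology_sdiff hc fun h' hh' => ?_
    exact apply_eq_zero_of_edge_eq hc (Finset.mem_singleton.1 hh').symm hker
  have h4 := Submodule.finrank_mono h3
  rw [Submodule.finrank_map_subtype_eq] at h4
  unfold loopNumber
  omega

open scoped Classical in
theorem loopNumber_le_sdiff_add_card (γ D : Finset E) :
    Γ.loopNumber γ ≤ Γ.loopNumber (γ \ D) + D.card := by
  induction D using Finset.induction_on with
  | empty => simp
  | insert e D he ih =>
    have := Γ.loopNumber_le_erase_add_one (γ \ D) e
    rw [← Finset.sdiff_insert] at this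
    rw [Finset.card_insert_of_notMem he]
    omega

open scoped Classical in
/-- An edge set that meets all cycles contains one of minimal size. -/
theorem exists_subset_card_eq_loopNumber (D : Finset E) : ∀ γ : Finset E,
    Γ.loopNumber (γ \ D) = 0 → ∃ D' ⊆ D, D'.card = Γ.loopNumber γ ∧
      Γ.loopNumber (γ \ D') = 0 := by
  induction D using Finset.induction_on with
  | empty => exact fun γ h => ⟨∅, subset_rfl, by simpa using h.symm, h⟩
  | insert e D he ih =>
    intro γ h
    by_cases hon : Γ.OnCycle γ e
    · have h1 := loopNumber_erase_lt_iff.2 hon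
      have h2 := Γ.loopNumber_le_erase_add_one γ e
      obtain ⟨D', hD', hcard, h0⟩ := ih (γ.erase e) (by
        rwa [Finset.erase_sdiff_comm, ← Finset.sdiff_insert])
      refine ⟨insert e D', Finset.insert_subset_insert _ hD', ?_, ?_⟩
      · rw [Finset.card_insert_of_notMem fun h' => he (hD' h'), hcard]
        omega
      · rwa [Finset.sdiff_insert, ← Finset.erase_sdiff_comm]
    · obtain ⟨D', hD', hcard, h0⟩ := ih γ (by
        rw [loopNumber_eq_zero_iff] at h ⊢
        rw [← h, Finset.sdiff_insert, Finset.erase_eq]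
        refine (firstHomology_sdiff_eq fun e' he' hon' => hon ?_).symm
        rw [← Finset.mem_singleton.1 he']
        exact hon'.mono Finset.sdiff_subset)
      exact ⟨D', hD'.trans (Finset.subset_insert _ _), hcard, h0⟩

open scoped Classical in
/-- In an edge set of minimal size that meets all cycles, every edge lies on a cycle. -/
theorem onCycle_of_card_eq_loopNumber (hcard : D.card = Γ.loopNumber γ)
    (h0 : Γ.loopNumber (γ \ D) = 0) (he : e ∈ D) : Γ.OnCycle γ e := by
  rw [← loopNumber_erase_lt_iff]
  have h1 := Γ.loopNumber_le_sdiff_add_card (γ.erase e) (D.erase e)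
  have h2 : Γ.loopNumber (γ.erase e \ D.erase e) ≤ Γ.loopNumber (γ \ D) :=
    loopNumber_mono fun x hx => by
      simp only [Finset.mem_sdiff, Finset.mem_erase] at hx ⊢
      tauto
  have h3 := Finset.card_erase_add_one he
  omega

end homology

/-! ### Spanning trees -/

section trees

variable {Γ} {γ T D : Finset E} {e : E} {v w : V}

theorem Joined.symm (h : Γ.Joined T v w) : Γ.Joined T w v :=
  Relation.EqvGen.symm _ _ h

theorem Joined.trans {u : V} (h : Γ.Joined T v w) (h' : Γ.Joined T w u) : Γ.Joined T v u :=
  Relation.EqvGen.trans _ _ _ h h'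

theorem joined_vert {h h' : H} (he : Γ.edge h = Γ.edge h') (hT : Γ.edge h ∈ T) :
    Γ.Joined T (Γ.vert h) (Γ.vert h') :=
  Relation.EqvGen.rel _ _ ⟨h, h', he, hT, rfl, rfl⟩

open scoped Classical in
/-- The ends of an edge on a cycle are joined by the rest of the cycle: otherwise the part of the
cycle at the vertices joined to one of the ends has non-zero total boundary. -/
theorem joined_erase_of_apply_ne_zero {c : H → ℚ} (hc : c ∈ Γ.firstHomology γ) {h h' : H}
    (he : Γ.edge h = Γ.edge h') (h0 : c h ≠ 0) :
    Γ.Joined (γ.erase (Γ.edge h)) (Γ.vert h) (Γ.vert h') := by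
  by_contra hn
  have hne : h ≠ h' := by
    rintro rfl
    exact hn (Relation.EqvGen.refl _)
  set P : H → Prop := fun x => Γ.Joined (γ.erase (Γ.edge h)) (Γ.vert h) (Γ.vert x) with hP
  have hV : ∑ x with P x, c x = 0 := by
    rw [← Finset.sum_fiberwise_of_maps_to (t := Finset.univ.image Γ.vert) (g := Γ.vert)
      fun x _ => Finset.mem_image_of_mem _ (Finset.mem_univ x)]
    refine Finset.sum_eq_zero fun v _ => ?_
    by_cases hv : Γ.Joined (γ.erase (Γ.edge h)) (Γ.vert h) v
    · rw [← hc.2.1 v, Finset.filter_filter]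
      refine Finset.sum_congr (Finset.filter_congr fun x _ => ?_) fun _ _ => rfl
      refine and_iff_right_of_imp ?_
      rintro rfl
      exact hv
    · refine Finset.sum_eq_zero fun x hx => ?_
      obtain ⟨hxP, rfl⟩ := Finset.mem_filter.1 hx
      exact absurd (Finset.mem_filter.1 hxP).2 hv
  -- The two halves of any other edge are joined, so only the half-edge `h` contributes.
  have hE : ∑ x with P x, c x = c h := by
    rw [← Finset.sum_fiberwise_of_maps_to (t := Finset.univ.image Γ.edge) (g := Γ.edge)
      fun x _ => Finset.mem_image_of_mem _ (Finset.mem_univ x)]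
    rw [Finset.sum_eq_single (Γ.edge h)]
    · refine (Finset.sum_eq_single h (fun x hx hxh => ?_) fun hh => ?_)
      · rw [Finset.mem_filter, Finset.mem_filter] at hx
        have hx' : x ∈ Finset.univ.filter fun x => Γ.edge x = Γ.edge h := by simp [hx.2]
        rw [filter_edge_eq_pair hne he, Finset.mem_insert, Finset.mem_singleton] at hx'
        rcases hx' with rfl | rfl
        · exact absurd rfl hxh
        · exact absurd hx.1.2 hn
      · refine absurd ?_ hh
        simp only [Finset.mem_filter, Finset.mem_univ, true_and, and_true]
        exact Relation.EqvGen.refl _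
    · intro e _ hne
      by_cases heγ : e ∈ γ
      · by_cases hex : ∃ y, Γ.edge y = e ∧ P y
        · obtain ⟨y, rfl, hy⟩ := hex
          rw [← hc.2.2 (Γ.edge y), Finset.filter_filter]
          refine Finset.sum_congr (Finset.filter_congr fun x _ => ?_) fun _ _ => rfl
          refine and_iff_right_of_imp fun hx => ?_
          exact hy.trans (joined_vert hx.symm (Finset.mem_erase.2 ⟨hne, heγ⟩))
        · refine Finset.sum_eq_zero fun x hx => ?_
          rw [Finset.mem_filter, Finset.mem_filter] at hx
          exact absurd ⟨x, hx.2, hx.1.2⟩ hex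
      · refine Finset.sum_eq_zero fun x hx => hc.1 x ?_
        rwa [(Finset.mem_filter.1 hx).2]
    · exact fun hh => absurd (Finset.mem_image_of_mem _ (Finset.mem_univ h)) hh
  exact h0 (hE.symm.trans hV)

open scoped Classical in
theorem joined_erase_of_onCycle (he : Γ.OnCycle γ e) (h : Γ.Joined γ v w) :
    Γ.Joined (γ.erase e) v w := by
  induction h with
  | rel v w h =>
    obtain ⟨h, h', hee, hγ, rfl, rfl⟩ := h
    by_cases heq : Γ.edge h = e
    · obtain ⟨c, hc, h₀, rfl, h0⟩ := he
      exact (joined_erase_of_apply_ne_zero hc heq.symm h0).symm.trans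
        (joined_erase_of_apply_ne_zero hc (heq.symm.trans hee) h0)
    · exact joined_vert hee (Finset.mem_erase.2 ⟨heq, hγ⟩)
  | refl v => exact Relation.EqvGen.refl _
  | symm v w _ ih => exact ih.symm
  | trans u v w _ _ ih ih' => exact ih.trans ih'

open scoped Classical in
/-- Removing an edge set of minimal size that meets all cycles does not disconnect anything. -/
theorem joined_sdiff (D : Finset E) : ∀ γ : Finset E, D.card = Γ.loopNumber γ →
    Γ.loopNumber (γ \ D) = 0 → Γ.Joined γ v w → Γ.Joined (γ \ D) v w := by
  induction D using Finset.induction_on with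
  | empty => exact fun γ _ _ h => by simpa using h
  | insert e D he ih =>
    intro γ hcard h0 h
    have hon := onCycle_of_card_eq_loopNumber hcard h0 (Finset.mem_insert_self e D)
    have h1 := loopNumber_erase_lt_iff.2 hon
    have h2 := Γ.loopNumber_le_erase_add_one γ e
    rw [Finset.card_insert_of_notMem he] at hcard
    rw [Finset.sdiff_insert, ← Finset.erase_sdiff_comm] at h0 ⊢
    exact ih _ (by omega) h0 (joined_erase_of_onCycle hon h)

open scoped Classical in
/-- A path is a `1`-chain whose boundary is the difference of its ends. -/
theorem Joined.exists_chain (h : Γ.Joined T v w) : ∃ c : H → ℚ,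
    (∀ h, Γ.edge h ∉ T → c h = 0) ∧
    (∀ u, ∑ h with Γ.vert h = u, c h = (if v = u then 1 else 0) - if w = u then 1 else 0) ∧
    ∀ e, ∑ h with Γ.edge h = e, c h = 0 := by
  induction h with
  | rel v w h =>
    obtain ⟨h, h', hee, hT, rfl, rfl⟩ := h
    refine ⟨Pi.single h 1 - Pi.single h' 1, fun x hx => ?_, fun u => ?_, fun e => ?_⟩
    · have h1 : x ≠ h := by rintro rfl; exact hx hT
      have h2 : x ≠ h' := by rintro rfl; exact hx (hee ▸ hT)
      simp [h1, h2]
    · simp [Finset.sum_sub_distrib, Pi.single_apply]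
    · simp [Finset.sum_sub_distrib, Pi.single_apply, hee]
  | refl v => exact ⟨0, by simp, by simp, by simp⟩
  | symm v w _ ih =>
    obtain ⟨c, h1, h2, h3⟩ := ih
    exact ⟨-c, fun h hh => by simp [h1 h hh], fun u => by simp [h2 u], fun e => by simp [h3 e]⟩
  | trans u v w _ _ ih ih' =>
    obtain ⟨c, h1, h2, h3⟩ := ih
    obtain ⟨c', h1', h2', h3'⟩ := ih'
    exact ⟨c + c', fun h hh => by simp [h1 h hh, h1' h hh],
      fun u => by simp [Finset.sum_add_distrib, h2 u, h2' u],
      fun e => by simp [Finset.sum_add_distrib, h3 e, h3' e]⟩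

open scoped Classical in
/-- An edge whose ends are joined in `T` closes a cycle with `T`. The edge must not be external,
which follows if it lies on some cycle. -/
theorem onCycle_insert (hT : ∀ v w, Γ.Joined γ v w → Γ.Joined T v w) (he : e ∉ T)
    (hon : Γ.OnCycle γ e) : Γ.OnCycle (insert e T) e := by
  have heγ := hon.mem
  obtain ⟨c, hc, h, rfl, h0⟩ := hon
  obtain ⟨h', hne, hee⟩ : ∃ h', h' ≠ h ∧ Γ.edge h' = Γ.edge h := by
    by_contra! hall
    refine h0 ?_
    rw [← hc.2.2 (Γ.edge h)]
    refine (Finset.sum_eq_single h (fun x hx hxh => ?_) fun hh => ?_).symm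
    · exact absurd (Finset.mem_filter.1 hx).2 (hall x hxh)
    · simp at hh
  obtain ⟨p, h1, h2, h3⟩ := (hT _ _ (joined_vert hee.symm heγ)).exists_chain
  refine ⟨p - (Pi.single h 1 - Pi.single h' 1), ⟨fun x hx => ?_, fun u => ?_, fun e => ?_⟩,
    h, rfl, ?_⟩
  · rw [Finset.mem_insert, not_or] at hx
    have hx1 : x ≠ h := by rintro rfl; exact hx.1 rfl
    have hx2 : x ≠ h' := by rintro rfl; exact hx.1 hee
    simp [h1 x hx.2, hx1, hx2]
  · simp [Finset.sum_sub_distrib, Pi.single_apply, h2 u]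
  · simp [Finset.sum_sub_distrib, Pi.single_apply, h3 e, hee]
  · simp [h1 h he, hne.symm]

variable [Fintype E]

open scoped Classical in
theorem isSpanningTree_compl (hcard : D.card = Γ.loopNumber Finset.univ)
    (h0 : Γ.loopNumber Dᶜ = 0) : Γ.IsSpanningTree Dᶜ := by
  refine ⟨h0, fun v w h => ?_⟩
  rw [Finset.compl_eq_univ_sdiff] at h0 ⊢
  exact joined_sdiff D _ hcard h0 h

open scoped Classical in
theorem IsSpanningTree.card_compl (hΓ : Γ.IsCore) (hT : Γ.IsSpanningTree T) :
    Tᶜ.card = Γ.loopNumber Finset.univ := by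
  obtain ⟨D, hD, hcard, h0⟩ := Γ.exists_subset_card_eq_loopNumber Tᶜ Finset.univ (by
    rw [← Finset.compl_eq_univ_sdiff, compl_compl]
    exact hT.1)
  rw [← hcard]
  congr 1
  refine (hD.antisymm fun e he => ?_).symm
  by_contra heD
  have hon : Γ.OnCycle (Finset.univ \ D) e := by
    refine (onCycle_insert hT.2 (Finset.mem_compl.1 he)
      (isCoreSubgraph_iff.1 hΓ e (Finset.mem_univ e))).mono (Finset.insert_subset ?_ fun x hx => ?_)
    · simpa using heD
    · have : x ∉ D := fun h => Finset.mem_compl.1 (hD h) hx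
      simpa using this
  obtain ⟨c, hc, h, -, hne⟩ := hon
  rw [loopNumber_eq_zero_iff.1 h0, Submodule.mem_bot] at hc
  exact hne (by simp [hc])

open scoped Classical in
theorem exists_isSpanningTree_superset (h0 : Γ.loopNumber γ = 0) :
    ∃ T, Γ.IsSpanningTree T ∧ γ ⊆ T := by
  obtain ⟨D, hD, hcard, h0⟩ := Γ.exists_subset_card_eq_loopNumber γᶜ Finset.univ (by
    rwa [← Finset.compl_eq_univ_sdiff, compl_compl])
  rw [← Finset.compl_eq_univ_sdiff] at h0
  refine ⟨Dᶜ, isSpanningTree_compl hcard h0, fun e he => ?_⟩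
  exact Finset.mem_compl.2 fun h => Finset.mem_compl.1 (hD h) he

end trees

/-! ### The greedy algorithm for spanning trees -/

section greedy

variable {Γ} {K : Type*} [Field K] {R : Subring K} {A : E → K}

open scoped Classical in
/-- The greedy algorithm: if in every non-empty core subgraph some `A_e` divides all the others
over `R`, then among the minimal edge sets `D` meeting all cycles there is one for which the product
`∏ e ∈ D, A e` divides all the others over `R`. -/
theorem exists_prod_div_prod_mem (hA : ∀ e, A e ≠ 0)
    (hpiv : ∀ μ : Finset E, μ.Nonempty → Γ.IsCoreSubgraph μ → ∃ e ∈ μ, ∀ f ∈ μ, A f / A e ∈ R) :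
    ∀ (n : ℕ) (γ : Finset E), Γ.loopNumber γ = n → ∃ D ⊆ γ, D.card = n ∧
      Γ.loopNumber (γ \ D) = 0 ∧ ∀ D' : Finset E, D'.card = n → Γ.loopNumber (γ \ D') = 0 →
        (∏ e ∈ D', A e) / ∏ e ∈ D, A e ∈ R
  | 0, γ, hγ => ⟨∅, Finset.empty_subset γ, rfl, by simpa using hγ, fun D' hD' _ => by
      rw [Finset.card_eq_zero.1 hD']
      simp [R.one_mem]⟩
  | n + 1, γ, hγ => by
    obtain ⟨e₁, he₁⟩ := exists_onCycle (Γ := Γ) (γ := γ) (by omega)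
    obtain ⟨e, he, hdiv⟩ := hpiv _ ⟨e₁, Finset.mem_filter.2 ⟨he₁.mem, he₁⟩⟩
      (Γ.isCoreSubgraph_filter γ)
    have hon := (Finset.mem_filter.1 he).2
    have h1 := loopNumber_erase_lt_iff.2 hon
    have h2 := Γ.loopNumber_le_erase_add_one γ e
    have hγe : Γ.loopNumber (γ.erase e) = n := by omega
    obtain ⟨D, hDγ, hD, hD0, hall⟩ := exists_prod_div_prod_mem hA hpiv n (γ.erase e) hγe
    have heD : e ∉ D := fun h => Finset.notMem_erase e γ (hDγ h)
    refine ⟨insert e D, Finset.insert_subset hon.mem (hDγ.trans (Finset.erase_subset e γ)),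
      by rw [Finset.card_insert_of_notMem heD, hD], ?_, fun D' hD' hD'0 => ?_⟩
    · rwa [Finset.sdiff_insert, ← Finset.erase_sdiff_comm]
    -- Exchange: all edges but one, `f`, of `D'` suffice to meet the cycles that avoid `e`.
    obtain ⟨D'', hsub, hcard, hD''0⟩ := Γ.exists_subset_card_eq_loopNumber (D'.erase e)
      (γ.erase e) (Nat.eq_zero_of_le_zero (hD'0 ▸ loopNumber_mono fun x hx => by
        simp only [Finset.mem_sdiff, Finset.mem_erase] at hx ⊢
        tauto))
    rw [hγe] at hcard
    have hsub' := hsub.trans (Finset.erase_subset e D')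
    obtain ⟨f, hf⟩ := Finset.card_eq_one.1 (show (D' \ D'').card = 1 by
      rw [Finset.card_sdiff_of_subset hsub']
      omega)
    have hfD : f ∈ D' := (Finset.mem_sdiff.1 (hf ▸ Finset.mem_singleton_self f)).1
    have hfon := onCycle_of_card_eq_loopNumber (hD'.trans hγ.symm) hD'0 hfD
    rw [Finset.prod_insert heD, ← Finset.prod_sdiff hsub', hf, Finset.prod_singleton,
      mul_div_mul_comm]
    exact R.mul_mem (hdiv f (Finset.mem_filter.2 ⟨hfon.mem, hfon⟩)) (hall D'' hcard hD''0)

end greedy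

end FeynmanGraph

/-! ### The graph polynomial on the iterated blow-up -/

namespace FeynmanGraph

open Proj

variable {H V E : Type*} [Fintype H] [Fintype E] {Γ : FeynmanGraph H V E} {k : Type*} [Field k]

theorem univ_notMem_coreSubgraphs : Finset.univ ∉ Γ.coreSubgraphs := fun h => h.2.1 rfl

theorem union_mem_coreSubgraphs [DecidableEq E] {μ ν : Finset E} (hμ : μ ∈ Γ.coreSubgraphs)
    (hν : ν ∈ Γ.coreSubgraphs) : μ ∪ ν ∈ insert Finset.univ Γ.coreSubgraphs := by
  by_cases h : μ ∪ ν = Finset.univ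
  · exact Or.inl h
  · exact Or.inr ⟨hμ.1.mono Finset.subset_union_left, h, hμ.2.2.union hν.2.2⟩

open scoped Classical in
/-- At every point of `P(Γ)`, one of the monomials of the graph polynomial divides all the
others. -/
theorem exists_isSpanningTree_prod_div_prod_mem (hΓ : Γ.IsCore)
    {R : LocalSubring (FunField k E)} (hR : R ∈ Γ.blowUp k) :
    ∃ T₀, Γ.IsSpanningTree T₀ ∧ ∀ T, Γ.IsSpanningTree T →
      (∏ e ∈ Tᶜ, coord k e) / ∏ e ∈ T₀ᶜ, coord k e ∈ R.toSubring := by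
  obtain ⟨D, -, hcard, h0, hD⟩ := exists_prod_div_prod_mem (Γ := Γ) (R := R.toSubring)
    (A := coord k) coord_ne_zero (fun μ hne hμ => by
      obtain ⟨e, he⟩ := exists_isPivot_of_mem_iteratedBlowUp
        (fun _ hμ _ hν => union_mem_coreSubgraphs hμ hν) univ_notMem_coreSubgraphs hR (ν := μ) (by
          by_cases h : μ = Finset.univ
          · exact Or.inl h
          · exact Or.inr ⟨hne, h, hμ⟩)
      exact ⟨e, he⟩) _ Finset.univ rfl
  rw [← Finset.compl_eq_univ_sdiff] at h0
  refine ⟨Dᶜ, isSpanningTree_compl hcard h0, fun T hT => ?_⟩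
  rw [compl_compl]
  refine hD _ (hT.card_compl hΓ) ?_
  rw [← Finset.compl_eq_univ_sdiff, compl_compl]
  exact hT.1

open scoped Classical in
/-- At a point outside the blown up linear spaces, one of the monomials of the graph polynomial
does not vanish. -/
theorem exists_isSpanningTree_inv_prod_mem {R : LocalSubring (FunField k E)} {e : E}
    (hR : R ∈ space k E) (he : chart k e ≤ R.toSubring)
    (hb : R ∉ blownUpLocus k Γ.coreSubgraphs (Fintype.card E)) :
    ∃ T, Γ.IsSpanningTree T ∧ (∏ f ∈ Tᶜ, coord k f / coord k e)⁻¹ ∈ R.toSubring := by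
  set γ := Finset.univ.filter fun f => coord k f / coord k e ∈ Model.maxIdeal R with hγ
  have h0 : Γ.loopNumber γ = 0 := by
    by_contra h0
    obtain ⟨f, hf⟩ := exists_onCycle h0
    set μ := γ.filter fun f => Γ.OnCycle γ f with hμ
    have hμγ : ∀ f ∈ μ, coord k f / coord k e ∈ Model.maxIdeal R := fun f hf =>
      (Finset.mem_filter.1 (Finset.mem_filter.1 hf).1).2
    have hμS : μ ∈ Γ.coreSubgraphs := by
      refine ⟨⟨f, Finset.mem_filter.2 ⟨hf.mem, hf⟩⟩, fun h => ?_, Γ.isCoreSubgraph_filter γ⟩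
      have he' := coord_div_coord_notMem (hμγ e (h ▸ Finset.mem_univ e))
      exact he' (he (coord_div_coord_mem_chart e e))
    obtain ⟨j, hj, hμj⟩ := exists_mem_stratum hμS (Fintype.card E) (by
      rw [remaining_card univ_notMem_coreSubgraphs]
      exact Set.notMem_empty μ)
    exact hb (Set.mem_iUnion₂.2 ⟨j, hj, Set.mem_iUnion₂.2 ⟨μ, hμj, mem_linearSpace hR he hμγ⟩⟩)
  obtain ⟨T, hT, hγT⟩ := exists_isSpanningTree_superset h0
  refine ⟨T, hT, ?_⟩
  rw [← Finset.prod_inv_distrib]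
  refine Subring.prod_mem _ fun f hf => Model.inv_mem_of_notMem_maxIdeal
    (he (coord_div_coord_mem_chart e f)) fun hm => Finset.mem_compl.1 hf (hγT ?_)
  exact Finset.mem_filter.2 ⟨Finset.mem_univ f, hm⟩

open scoped Classical in
/-- A quotient of monomials of the graph polynomial that is regular at a non-negative point has a
non-negative value there. -/
theorem exists_eval_eq_of_mem_nonnegPoints [Algebra k ℂ] (hΓ : Γ.IsCore)
    {x : ComplexPoint k (Γ.blowUp k)} (hx : x ∈ nonnegPoints k (Γ.blowUp k)) {T T₀ : Finset E}
    (hT : Γ.IsSpanningTree T) (hT₀ : Γ.IsSpanningTree T₀)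
    (hmem : (∏ e ∈ Tᶜ, coord k e) / ∏ e ∈ T₀ᶜ, coord k e ∈ x.localRing.toSubring) :
    ∃ r : ℝ, 0 ≤ r ∧ x.eval ⟨_, hmem⟩ = (r : ℂ) := by
  set q := (∏ e ∈ Tᶜ, coord k e) / ∏ e ∈ T₀ᶜ, coord k e with hq
  by_cases hi : q⁻¹ ∈ x.localRing.toSubring
  · let m : E → ℤ := fun e => (if e ∈ Tᶜ then 1 else 0) - if e ∈ T₀ᶜ then 1 else 0
    have hchar : character k m = q := by
      have hind : ∀ s : Finset E,
          ∏ e, coord k e ^ (if e ∈ s then 1 else 0 : ℤ) = ∏ e ∈ s, coord k e := by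
        intro s
        rw [← Finset.univ_inter s, ← Finset.prod_ite_mem, Finset.univ_inter]
        refine Finset.prod_congr rfl fun e _ => ?_
        split_ifs
        exacts [zpow_one _, zpow_zero _]
      rw [hq, ← hind Tᶜ, ← hind T₀ᶜ, ← Finset.prod_div_distrib]
      exact Finset.prod_congr rfl fun e _ => zpow_sub₀ (coord_ne_zero e) _ _
    have hm : m ∈ orbitLattice k x.localRing := by
      refine ⟨?_, hchar ▸ hmem, hchar ▸ hi⟩
      simp only [m, Finset.sum_sub_distrib, Finset.sum_ite_mem, Finset.univ_inter,
        Finset.sum_const, hT.card_compl hΓ, hT₀.card_compl hΓ, sub_self]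
    obtain ⟨r, hr, hxr⟩ := hx m hm
    refine ⟨r, hr.le, ?_⟩
    rw [← hxr]
    congr 1
    exact Subtype.ext hchar.symm
  · refine ⟨0, le_rfl, ?_⟩
    by_contra h0
    have hu := x.isLocalHom_eval.map_nonunit _ (isUnit_iff_ne_zero.2 (by simpa using h0))
    obtain ⟨b, hb⟩ := hu.exists_right_inv
    refine hi ?_
    rw [← eq_inv_of_mul_eq_one_right (congrArg Subtype.val hb : q * (b : FunField k E) = 1)]
    exact b.2

end FeynmanGraph

theorem mainTheorem3 {H V E : Type*} [Fintype H] [Fintype E] (Γ : FeynmanGraph H V E)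
    (hΓ : Γ.IsCore) (k : Type*) [Field k] [Algebra k ℂ] :
    Disjoint (Proj.pointsOn k (Γ.blowUp k) (Γ.strictTransform k))
      (Proj.nonnegPoints k (Γ.blowUp k)) := by
  classical
  rw [Set.disjoint_left]
  intro x hxY hx
  obtain ⟨T₀, hT₀, hdiv⟩ := FeynmanGraph.exists_isSpanningTree_prod_div_prod_mem hΓ x.mem
  let trees := {T : Finset E // Γ.IsSpanningTree T}
  let q : trees → Proj.FunField k E := fun T =>
    (∏ e ∈ T.1ᶜ, Proj.coord k e) / ∏ e ∈ T₀ᶜ, Proj.coord k e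
  have hq : ∀ T, q T ∈ x.localRing.toSubring := fun T => hdiv T.1 T.2
  have hprod : ∀ T : Finset E, ∏ e ∈ Tᶜ, Proj.coord k e ≠ 0 := fun T =>
    Finset.prod_ne_zero_iff.2 fun e _ => Proj.coord_ne_zero e
  -- The quotient of `ψ` by its divisor at the point is positive at the point.
  have hF : ∑ T, q T ∈ x.localRing.toSubring := Subring.sum_mem _ fun T _ => hq T
  have hevalF : x.eval ⟨∑ T, q T, hF⟩ ≠ 0 := by
    choose r hr hxr using fun T : trees =>
      FeynmanGraph.exists_eval_eq_of_mem_nonnegPoints hΓ hx T.2 hT₀ (hq T)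
    have hsum : (⟨∑ T, q T, hF⟩ : x.localRing.toSubring) = ∑ T, ⟨q T, hq T⟩ :=
      Subtype.ext (by simp)
    have h1 : r ⟨T₀, hT₀⟩ = 1 := by
      have : (⟨q ⟨T₀, hT₀⟩, hq ⟨T₀, hT₀⟩⟩ : x.localRing.toSubring) = 1 :=
        Subtype.ext (div_self (hprod T₀))
      have h := hxr ⟨T₀, hT₀⟩
      rw [this, map_one] at h
      exact_mod_cast h.symm
    rw [hsum, map_sum, Finset.sum_congr rfl fun T _ => hxr T, ← Complex.ofReal_sum]
    refine Complex.ofReal_ne_zero.2 (ne_of_gt ?_)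
    refine Finset.sum_pos' (fun T _ => hr T) ⟨⟨T₀, hT₀⟩, Finset.mem_univ _, ?_⟩
    rw [h1]
    exact one_pos
  have hF0 : ∑ T, q T ≠ 0 := fun h0 => hevalF (by
    rw [show (⟨∑ T, q T, hF⟩ : x.localRing.toSubring) = 0 from Subtype.ext h0, map_zero])
  have hFi : (∑ T, q T)⁻¹ ∈ x.localRing.toSubring := by
    have hu := x.isLocalHom_eval.map_nonunit _ (isUnit_iff_ne_zero.2 hevalF)
    refine Model.inv_mem_of_notMem_maxIdeal hF ?_
    rintro ⟨_, hm⟩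
    rw [IsLocalRing.mem_maximalIdeal, mem_nonunits_iff] at hm
    exact hm hu
  -- Near the point there is no point of the hypersurface outside the blown up linear spaces.
  -- (`none` stands for the inverse of the quotient, `some T` for the quotient of monomials at `T`.)
  obtain ⟨R, ⟨-, R₀, ⟨hsp, e, hchart, hψ⟩, hb, hle⟩, hR⟩ :=
    Model.exists_mem_of_mem_closureIn hxY (fun o : Option trees => o.elim (∑ T, q T)⁻¹ q)
      (by rintro (_ | T); exacts [hFi, hq T])
  obtain ⟨T₁, hT₁, hT₁i⟩ := FeynmanGraph.exists_isSpanningTree_inv_prod_mem hsp hchart hb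
  let y : Finset E → Proj.FunField k E := fun T => ∏ f ∈ Tᶜ, Proj.coord k f / Proj.coord k e
  have hyq : ∀ T : trees, y T.1 = q T * y T₀ := by
    intro T
    simp only [y, q, Finset.prod_div_distrib, Finset.prod_const, T.2.card_compl hΓ,
      hT₀.card_compl hΓ]
    rw [div_mul_div_comm, mul_comm (∏ f ∈ T₀ᶜ, Proj.coord k f), mul_div_mul_right _ _ (hprod T₀)]
  have hψ' : MvPolynomial.aeval (fun f => Proj.coord k f / Proj.coord k e)
      (Γ.graphPolynomial k) = (∑ T, q T) * y T₀ := by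
    rw [FeynmanGraph.graphPolynomial, map_sum, Finset.sum_mul, Finset.sum_subtype _
      (p := fun T => Γ.IsSpanningTree T) (by simp)]
    refine Finset.sum_congr rfl fun T _ => ?_
    rw [← hyq T]
    simp [y, map_prod]
  rw [hψ'] at hψ
  have hy0 : y T₀ ≠ 0 :=
    Finset.prod_ne_zero_iff.2 fun f _ => div_ne_zero (Proj.coord_ne_zero f) (Proj.coord_ne_zero e)
  refine mul_ne_zero hF0 hy0
    ((Model.mem_maxIdeal_iff.1 (Model.maxIdeal_subset_of_le hle hψ)).2 ?_)
  rw [mul_inv]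
  refine Subring.mul_mem _ (hR none) ?_
  have hy1 : (y T₀)⁻¹ = q ⟨T₁, hT₁⟩ * (y T₁)⁻¹ := by
    have h1 : q ⟨T₁, hT₁⟩ ≠ 0 := div_ne_zero (hprod T₁) (hprod T₀)
    rw [hyq ⟨T₁, hT₁⟩, mul_inv, mul_inv_cancel_left₀ h1]
  rw [hy1]
  exact Subring.mul_mem _ (hR (some ⟨T₁, hT₁⟩)) (hle.1 hT₁i)
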